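/- Let $\Lambda\subset\mathbb C$ be a nonempty finite set, let $c_\lambda\in\mathbb C\setminus\{0\}$ for $\lambda\in\Lambda$, and let $$f(z)=\sum_{\lambda\in\Lambda}c_\lambda e^{\bar\lambda z}\qquad(z\in\mathbb C)$$ be the exponential sum with spectrum $\Lambda$. For $r\ge 0$ let $N(f,r)$ be the number of zeros of $f$, counted with multiplicities, in the open disk $B_r=\{z\in\mathbb C:|z|<r\}$. Let $l(f)$ be the semiperimeter (half of the sum of the lengths of the sides) of the Newton polygon $\Delta=\mathrm{conv}(\Lambda)$; if $\Delta$ is a segment, $l(f)$ is by convention the length of this segment, and if $\Delta$ is a point, $l(f)=0$. Then $N(f,r)$ is finite for every $r\ge0$ and $$N(f,r)=\frac{r}{\pi}\,l(f)+O(1),$$ that is, there is a constant $C$, depending only on $f$, such that $\left|N(f,r)-\frac{r}{\pi}\,l(f)\right|\le C$ for all $r\ge 0$. (Equivalently, the main term is $\frac{r}{2\pi}$ times the perimeter of $\Delta$, where a segment has perimeter twice its length.) -/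

import Mathlib

noncomputable section

namespace ExpSum

/-- The exponential sum `z ↦ ∑_{l ∈ S} c_l exp (conj l * z)` with exponents in the finite
set `S ⊂ ℂ`. The set `S` is the spectrum of the sum when all `c l`, `l ∈ S`, are nonzero. -/
def expSum (S : Finset ℂ) (c : ℂ → ℂ) (z : ℂ) : ℂ :=
  ∑ l ∈ S, c l * Complex.exp ((starRingEnd ℂ) l * z)

/-- The Newton polygon of an exponential sum with spectrum `S`: the convex hull of `S`. -/
def newtonPolygon (S : Finset ℂ) : Set ℂ := convexHull ℝ (S : Set ℂ)

/-- `(a, b)` is a positively oriented side of the convex polygon `P`: `a` and `b` are distinct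
vertices (extreme points) of `P`, and `P` lies in the closed half-plane to the left of the
directed line from `a` to `b`. Every side of a polygon with nonempty interior has exactly one
positive orientation; for a segment with endpoints `a ≠ b` both `(a, b)` and `(b, a)` are
positively oriented sides (one for each of the two outward normals). -/
def IsOrientedSide (P : Set ℂ) (a b : ℂ) : Prop :=
  a ≠ b ∧ a ∈ P.extremePoints ℝ ∧ b ∈ P.extremePoints ℝ ∧
    ∀ w ∈ P, 0 ≤ ((starRingEnd ℂ) (b - a) * (w - a)).im

/-- The set of positively oriented sides of `P`. -/
def orientedSides (P : Set ℂ) : Set (ℂ × ℂ) := {p | IsOrientedSide P p.1 p.2}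

/-- The convex hull of a finite set has finitely many sides, so that the sum in the
definition `perimeter` is a genuine finite sum for a Newton polygon. -/
theorem finite_orientedSides_newtonPolygon (S : Finset ℂ) :
    (orientedSides (newtonPolygon S)).Finite := by
  refine ((S ×ˢ S).finite_toSet).subset ?_
  rintro ⟨a, b⟩ ⟨-, ha, hb, -⟩
  simpa using And.intro (extremePoints_convexHull_subset ha) (extremePoints_convexHull_subset hb)

/-- The perimeter of a convex polygon: the sum of the lengths of its sides. A polygon which is
a segment has two oriented sides, hence perimeter twice its length; a point has perimeter `0`. -/
def perimeter (P : Set ℂ) : ℝ := ∑ᶠ p ∈ orientedSides P, dist p.1 p.2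

/-- Half of the perimeter; for a segment this is its length. -/
def semiperimeter (P : Set ℂ) : ℝ := perimeter P / 2

/-- The zeros of `f` in the open disk of radius `r` centered at the origin. -/
def zerosInDisk (f : ℂ → ℂ) (r : ℝ) : Set ℂ := {z ∈ Metric.ball (0 : ℂ) r | f z = 0}

/-- The number of zeros of `f` in the open disk of radius `r` centered at the origin, counted
with multiplicities. -/
def zeroCount (f : ℂ → ℂ) (r : ℝ) : ℕ := ∑ᶠ z ∈ zerosInDisk f r, analyticOrderNatAt f z

end ExpSum

end

/-!
The proof compares the exponential sum `f` with its largest term. Put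
`H z = max (log ‖c l‖ + Re (conj l * z))`, the maximum being over the spectrum (`logMaxTerm`), and
let `M s` be the average of `log ‖f‖` over the circle of radius `s` around `0`.

* By Jensen's formula, `M s₂ - M s₁` lies between `log (s₂ / s₁)` times the number of zeros in the
  disk of radius `s₁` and `log (s₂ / s₁)` times that in any disk of radius `r > s₂`
  (`zeroCount_mul_log_le`, `le_zeroCount_mul_log`). Hence the zeros in the disk of radius `r` are
  known up to a bounded error once `M s₂ - M s₁ = A * (s₂ - s₁) + O(1 / r)` is known for some
  radii `s₁`, `s₂` near `r` whose difference lies between `1` and `3`.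
* Along rays `H` grows like the support function of the spectrum, so that the circle averages of
  `H` satisfy this relation, where `2 * π * A` is the integral of the support function over all
  directions (`circleAverage_logMaxTerm_sub`). By Cauchy's formula this integral is the perimeter
  of the Newton polygon (`integral_supportFn`). Cauchy's formula is proved with second differences
  of a small fixed step `e`: the function `h (t + e) + h (t - e) - 2 * cos e * h t` vanishes unless
  `t` is near the normal of a side, and a side contributes its length times a function of integral
  `2 * (1 - cos e)`. No cyclic ordering of the vertices is needed.
* It remains to see that the circle averages of `log ‖f‖` and `H` differ by `O(1 / s)` for some
  radius `s` in each interval of length one (`exists_radius_circleAverage_close`). This follows if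
  the area integral of `|log ‖f‖ - H|` over the annulus `r ≤ ‖z‖ ≤ r + 1` is bounded
  (`exists_lintegral_annulus_le`). Away from the lines on which two terms of `f` with different
  exponents have comparable size, the integrand is exponentially small
  (`abs_log_sub_logMaxTerm_le`). The rest of the annulus is covered by a bounded number of disks of
  fixed radius, and on each of them the integral is bounded uniformly by the mean value inequality
  for `log ‖f‖` at a nearby point at which one term dominates (`exists_lintegral_closedBall_le`).
-/

noncomputable section

namespace ExpSum

open Real MeasureTheory

/-! ### Directions, projections and sides of the Newton polygon -/

/-- The scalar product of the plane vector `v` with the unit vector in direction `t`. -/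
def proj (t : ℝ) (v : ℂ) : ℝ := v.re * cos t + v.im * sin t

/-- The scalar product of the plane vector `v` with the unit vector in direction `t + π / 2`. -/
def coproj (t : ℝ) (v : ℂ) : ℝ := v.im * cos t - v.re * sin t

/-- The determinant of the pair of plane vectors `d`, `v`. -/
def cross (d v : ℂ) : ℝ := d.re * v.im - d.im * v.re

lemma im_conj_mul (d v : ℂ) : ((starRingEnd ℂ) d * v).im = cross d v := by
  simp [cross, Complex.mul_im]; ring

lemma proj_add_angle (t e : ℝ) (v : ℂ) :
    proj (t + e) v = cos e * proj t v + sin e * coproj t v := by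
  simp only [proj, coproj, cos_add, sin_add]; ring

lemma proj_sub_angle (t e : ℝ) (v : ℂ) :
    proj (t - e) v = cos e * proj t v - sin e * coproj t v := by
  simp only [proj, coproj, cos_sub, sin_sub]; ring

lemma proj_sub (t : ℝ) (v w : ℂ) : proj t (v - w) = proj t v - proj t w := by
  simp [proj]; ring

lemma coproj_sub (t : ℝ) (v w : ℂ) : coproj t (v - w) = coproj t v - coproj t w := by
  simp [coproj]; ring

lemma cross_eq_frame (t : ℝ) (d v : ℂ) :
    cross d v = proj t d * coproj t v - coproj t d * proj t v := by
  simp only [cross, proj, coproj]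
  linear_combination (-(d.re * v.im) + d.im * v.re) * (sin_sq_add_cos_sq t)

lemma eq_of_frame_eq {t : ℝ} {v w : ℂ} (h1 : proj t v = proj t w) (h2 : coproj t v = coproj t w) :
    v = w := by
  simp only [proj, coproj] at h1 h2
  have h := sin_sq_add_cos_sq t
  apply Complex.ext
  · linear_combination cos t * h1 - sin t * h2 - (v.re - w.re) * h
  · linear_combination sin t * h1 + cos t * h2 - (v.im - w.im) * h

lemma abs_coproj_le (t : ℝ) (v : ℂ) : |coproj t v| ≤ ‖v‖ := by
  rw [← sq_le_sq₀ (abs_nonneg _) (norm_nonneg _), sq_abs, ← Complex.normSq_eq_norm_sq,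
    Complex.normSq_apply, coproj]
  have h := sin_sq_add_cos_sq t
  nlinarith [sq_nonneg (v.re * cos t + v.im * sin t)]

/-- `IsFineAngle S e` says that the angle `e` is so small compared with the finite set `S` that
two nonparallel differences of points of `S` cannot both be orthogonal to directions in a common
interval of length `2 * e`; see `IsFineAngle.cross_eq_zero`. -/
structure IsFineAngle (S : Finset ℂ) (e : ℝ) : Prop where
  pos : 0 < e
  lt : e < π / 2
  sin_lt : ∀ a ∈ S, ∀ b ∈ S, ∀ c ∈ S, ∀ d ∈ S, cross (b - a) (d - c) ≠ 0 →
    2 * sin e * ‖b - a‖ * ‖d - c‖ < cos e * |cross (b - a) (d - c)|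

lemma exists_isFineAngle (S : Finset ℂ) : ∃ e, IsFineAngle S e := by
  have hev : ∀ᶠ e in nhdsWithin (0 : ℝ) (Set.Ioi 0), IsFineAngle S e := by
    have h1 : ∀ᶠ e in nhdsWithin (0 : ℝ) (Set.Ioi 0), 0 < e := self_mem_nhdsWithin
    have h2 : ∀ᶠ e in nhdsWithin (0 : ℝ) (Set.Ioi 0), e < π / 2 :=
      nhdsWithin_le_nhds (Iio_mem_nhds (by positivity))
    have h3 : ∀ᶠ e in nhdsWithin (0 : ℝ) (Set.Ioi 0),
        ∀ a ∈ S, ∀ b ∈ S, ∀ c ∈ S, ∀ d ∈ S, cross (b - a) (d - c) ≠ 0 →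
          2 * sin e * ‖b - a‖ * ‖d - c‖ < cos e * |cross (b - a) (d - c)| := by
      simp only [Filter.eventually_all_finset]
      intro a _ b _ c _ d _
      rw [Filter.eventually_imp_distrib_left]
      intro hne
      have hl : Continuous fun e : ℝ ↦ 2 * sin e * ‖b - a‖ * ‖d - c‖ := by fun_prop
      have hr : Continuous fun e : ℝ ↦ cos e * |cross (b - a) (d - c)| := by fun_prop
      apply nhdsWithin_le_nhds
      exact (isOpen_lt hl hr).mem_nhds (by simpa using hne)
    filter_upwards [h1, h2, h3] with e h1 h2 h3
    exact ⟨h1, h2, h3⟩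
  exact hev.exists

namespace IsFineAngle

variable {S : Finset ℂ} {e : ℝ}

lemma cos_pos (he : IsFineAngle S e) : 0 < cos e :=
  cos_pos_of_mem_Ioo ⟨by linarith [he.pos, pi_pos], he.lt⟩

lemma sin_pos (he : IsFineAngle S e) : 0 < sin e :=
  sin_pos_of_pos_of_lt_pi he.pos (by linarith [he.lt, pi_pos])

/-- If the projections of two differences of points of `S` both change sign between the
directions `t - e` and `t + e`, then these differences are parallel. -/
lemma cross_eq_zero (he : IsFineAngle S e) (t : ℝ) {a b c d : ℂ} (ha : a ∈ S) (hb : b ∈ S)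
    (hc : c ∈ S) (hd : d ∈ S) (h1 : proj (t + e) (b - a) * proj (t - e) (b - a) ≤ 0)
    (h2 : proj (t + e) (d - c) * proj (t - e) (d - c) ≤ 0) : cross (b - a) (d - c) = 0 := by
  by_contra hne
  have hlt := he.sin_lt a ha b hb c hc d hd hne
  have hC := he.cos_pos
  have hs := he.sin_pos
  have key : ∀ v : ℂ, proj (t + e) v * proj (t - e) v ≤ 0 →
      cos e * |proj t v| ≤ sin e * ‖v‖ := by
    intro v hv
    rw [proj_add_angle, proj_sub_angle] at hv
    have : cos e * |proj t v| ≤ sin e * |coproj t v| := by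
      rw [← abs_of_pos hC, ← abs_of_pos hs, ← abs_mul, ← abs_mul]
      apply sq_le_sq.mp
      nlinarith
    exact this.trans (by gcongr; exact abs_coproj_le t v)
  have k1 := key _ h1
  have k2 := key _ h2
  have : cos e * |cross (b - a) (d - c)| ≤ 2 * sin e * ‖b - a‖ * ‖d - c‖ := by
    rw [cross_eq_frame t]
    calc _ ≤ cos e * (|proj t (b - a)| * |coproj t (d - c)|
          + |coproj t (b - a)| * |proj t (d - c)|) := by
          rw [← abs_mul, ← abs_mul]
          gcongr
          exact abs_sub _ _
      _ = (cos e * |proj t (b - a)|) * |coproj t (d - c)|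
          + |coproj t (b - a)| * (cos e * |proj t (d - c)|) := by ring
      _ ≤ (sin e * ‖b - a‖) * ‖d - c‖ + ‖b - a‖ * (sin e * ‖d - c‖) := by
          gcongr
          · exact abs_coproj_le t _
          · exact abs_coproj_le t _
      _ = _ := by ring
  linarith

end IsFineAngle

lemma isOrientedSide_iff_cross {P : Set ℂ} {a b : ℂ} : IsOrientedSide P a b ↔
    a ≠ b ∧ a ∈ P.extremePoints ℝ ∧ b ∈ P.extremePoints ℝ ∧
      ∀ w ∈ P, 0 ≤ cross (b - a) (w - a) := by
  simp only [IsOrientedSide, im_conj_mul]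

/-- The contribution of the oriented side `p` to the second difference with step `e` of the
support function at direction `t`. -/
def sideKernel (e t : ℝ) (p : ℂ × ℂ) : ℝ :=
  max 0 (min (proj (t + e) (p.2 - p.1)) (proj (t - e) (p.1 - p.2)))

/-- A lower bound of a linear functional on `S` is one on the Newton polygon. -/
lemma le_on_newtonPolygon {S : Finset ℂ} {u v : ℝ} {k : ℝ}
    (h : ∀ w ∈ S, k ≤ u * w.re + v * w.im) : ∀ w ∈ newtonPolygon S, k ≤ u * w.re + v * w.im := by
  let l : ℂ →ₗ[ℝ] ℝ := u • Complex.reLm + v • Complex.imLm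
  have hl : ∀ w, l w = u * w.re + v * w.im := fun w ↦ by simp [l]
  have hsub : newtonPolygon S ⊆ {w | k ≤ l w} :=
    convexHull_min (fun w hw ↦ by simpa [hl] using h w hw) (convex_halfSpace_ge l.isLinear k)
  intro w hw
  simpa [hl] using hsub hw

/-- A point at which some linear functional attains its minimum over a set, and attains it
nowhere else on the set, is an extreme point. -/
lemma mem_extremePoints_of_unique_min {P : Set ℂ} {u v : ℝ} {a : ℂ} (ha : a ∈ P)
    (h : ∀ w ∈ P, u * a.re + v * a.im ≤ u * w.re + v * w.im)
    (h' : ∀ w ∈ P, u * w.re + v * w.im = u * a.re + v * a.im → w = a) :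
    a ∈ P.extremePoints ℝ := by
  refine ⟨ha, fun x hx y hy hxy ↦ ?_⟩
  obtain ⟨α, β, hα, hβ, hαβ, rfl⟩ := hxy
  apply h' x hx
  have h1 := h x hx
  have h2 := h y hy
  have hre : (α • x + β • y).re = α * x.re + β * y.re := by simp
  have him : (α • x + β • y).im = α * x.im + β * y.im := by simp
  rw [hre, him] at h1 h2 ⊢
  obtain rfl : β = 1 - α := by linarith
  refine le_antisymm ?_ h1
  refine le_of_mul_le_mul_left ?_ hα
  linear_combination (1 - α) * h2

/-! ### Second differences of the support function -/

section RealInequalities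

/-! In the following inequalities, `C = cos e` and `s = sin e`, and `(dx, dy)` and `(X, Y)` are the
coordinates of `q - p` and `w - p` in the orthonormal frame of direction `t`, where `(p, q)` is a
candidate for a side and `w` is another point of the polygon. Thus `C * X + s * Y` and
`C * X - s * Y` are the projections of `w - p` in the directions `t + e` and `t - e`, and
`dx * Y - dy * X` is nonnegative if and only if `w` is to the left of the line from `p` to `q`. -/

variable {C s dx dy X Y : ℝ}

/-- If `w` is maximal in both directions `t + e` and `t - e`, then a side `(p, q)` with `w` on its
left does not contribute to the second difference at `t`. -/
lemma min_le_zero_of_common_max (hC : 0 < C) (hs : 0 < s) (h1 : 0 ≤ C * X - s * Y)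
    (h2 : 0 ≤ C * (X - dx) + s * (Y - dy)) (h3 : 0 ≤ dx * Y - dy * X) :
    min (C * dx + s * dy) (-(C * dx - s * dy)) ≤ 0 := by
  by_contra! h
  obtain ⟨ha, hb⟩ := lt_min_iff.mp h
  have hX : 0 < X := by nlinarith
  have hX' : 0 < X - dx := by nlinarith
  rcases le_total 0 dx with hd | hd
  · nlinarith [mul_nonneg hd h1, mul_pos hX hb]
  · nlinarith [mul_nonneg (neg_nonneg.mpr hd) h2, mul_pos hX' ha]

/-- If `p` is maximal in direction `t - e`, then `w` is to the left of the line from `p` to `q`. The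
hypothesis `hpar` expresses that `w - p` is parallel to `q - p` if its projection changes sign. -/
lemma cross_nonneg_of_max (hC : 0 < C) (hs : 0 < s) (h1 : 0 < C * dx + s * dy)
    (h2 : 0 < -(C * dx - s * dy)) (h3 : C * X - s * Y ≤ 0)
    (hpar : (C * X + s * Y) * (C * X - s * Y) ≤ 0 → dx * Y - dy * X = 0) :
    0 ≤ dx * Y - dy * X := by
  by_contra! h
  have hneg : C * X + s * Y < 0 := by
    by_contra! h'
    have := hpar (mul_nonpos_of_nonneg_of_nonpos h' h3)
    linarith
  have hX : X < 0 := by nlinarith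
  have : 0 ≤ s * (dx * Y - dy * X) := by
    rcases le_total 0 dx with hd | hd
    · nlinarith [mul_nonneg hd (neg_nonneg.mpr h3), mul_pos (neg_pos.mpr hX) h2]
    · nlinarith [mul_nonneg (neg_nonneg.mpr hd) (neg_pos.mpr hneg).le,
        mul_pos (neg_pos.mpr hX) h1]
  nlinarith

/-- A point to the left of a contributing side `(p, q)` that is beyond `p` in direction `t - e` is
not beyond `p` in direction `t + e`. -/
lemma le_of_left_of_side (hC : 0 < C) (hs : 0 < s) (h1 : 0 < C * dx + s * dy)
    (h2 : 0 < -(C * dx - s * dy)) (h3 : 0 ≤ dx * Y - dy * X) (h4 : 0 < C * X - s * Y) :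
    C * X + s * Y ≤ 0 := by
  by_contra! h
  have hX : 0 < X := by nlinarith
  rcases le_total 0 dx with hd | hd
  · nlinarith [mul_nonneg hd h4.le, mul_pos hX h2, mul_nonneg hs.le h3]
  · nlinarith [mul_nonneg (neg_nonneg.mpr hd) h.le, mul_pos hX h1, mul_nonneg hs.le h3]

/-- If `p` and `q` are maximal in the directions `t - e` and `t + e`, then the larger of their
projections in direction `t` is maximal. -/
lemma le_max_of_max (hC : 0 < C) (hs : 0 < s)
    (h3 : C * X - s * Y ≤ 0) (h4 : C * (X - dx) + s * (Y - dy) ≤ 0)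
    (h5 : 0 ≤ dx * Y - dy * X) (hd : 0 < dy) : X ≤ max 0 dx := by
  by_contra! h
  obtain ⟨hX, hX'⟩ := max_lt_iff.mp h
  have hY : 0 < Y := by nlinarith
  have hY' : Y < dy := by nlinarith
  have hdx : 0 < dx := by
    by_contra! hdx
    nlinarith [mul_pos hd hX]
  nlinarith [mul_pos hd (sub_pos.mpr hX'), mul_pos hdx (sub_pos.mpr hY')]

end RealInequalities


/-- The support function of the Newton polygon of `S` in direction `t`. -/
def supportFn (S : Finset ℂ) (hS : S.Nonempty) (t : ℝ) : ℝ := S.sup' hS (proj t)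

lemma supportFn_eq_of_max {S : Finset ℂ} (hS : S.Nonempty) {t : ℝ} {a : ℂ} (ha : a ∈ S)
    (h : ∀ w ∈ S, proj t w ≤ proj t a) : supportFn S hS t = proj t a :=
  le_antisymm (Finset.sup'_le hS _ h) (Finset.le_sup' (proj t) ha)

lemma proj_eq_re_im (t : ℝ) (v : ℂ) : proj t v = cos t * v.re + sin t * v.im := by
  simp [proj]; ring

variable {S : Finset ℂ}

lemma IsOrientedSide.mem {a b : ℂ} (h : IsOrientedSide (newtonPolygon S) a b) : a ∈ S ∧ b ∈ S :=
  ⟨by simpa using extremePoints_convexHull_subset h.2.1,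
    by simpa using extremePoints_convexHull_subset h.2.2.1⟩

lemma IsOrientedSide.cross_nonneg {a b : ℂ} (h : IsOrientedSide (newtonPolygon S) a b) {w : ℂ}
    (hw : w ∈ S) : 0 ≤ cross (b - a) (w - a) := by
  have := h.2.2.2 w (subset_convexHull ℝ _ (by simpa using hw))
  rwa [im_conj_mul] at this

/-- If one point of `S` is maximal in both directions `t - e` and `t + e`, then no side contributes
to the second difference at `t`. -/
lemma sideKernel_eq_zero_of_common_max {e t : ℝ} (he : IsFineAngle S e) {l : ℂ} (hl : l ∈ S)
    (h1 : ∀ w ∈ S, proj (t + e) w ≤ proj (t + e) l)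
    (h2 : ∀ w ∈ S, proj (t - e) w ≤ proj (t - e) l) {p : ℂ × ℂ}
    (hp : IsOrientedSide (newtonPolygon S) p.1 p.2) : sideKernel e t p = 0 := by
  obtain ⟨hp1, hp2⟩ := hp.mem
  have hc := hp.cross_nonneg hl
  rw [cross_eq_frame t] at hc
  have k1 := h1 _ hp2
  have k2 := h2 _ hp1
  rw [proj_add_angle, proj_add_angle] at k1
  rw [proj_sub_angle, proj_sub_angle] at k2
  have := min_le_zero_of_common_max he.cos_pos he.sin_pos
    (dx := proj t (p.2 - p.1)) (dy := coproj t (p.2 - p.1)) (X := proj t (l - p.1))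
    (Y := coproj t (l - p.1))
    (by simp only [proj_sub, coproj_sub]; linarith)
    (by simp only [proj_sub, coproj_sub]; linarith) hc
  rw [← proj_add_angle, ← proj_sub_angle, proj_sub (t - e), neg_sub, ← proj_sub] at this
  rw [sideKernel, max_eq_left this]

/-- An extreme point `p` cannot lie strictly between two points `w` and `q`; the latter is
expressed by collinearity and the signs of a projection. -/
lemma not_between_of_mem_extremePoints {P : Set ℂ} {p q w : ℂ} (hp : p ∈ P.extremePoints ℝ)
    (hq : q ∈ P) (hw : w ∈ P) {t : ℝ} (hcr : cross (q - p) (w - p) = 0)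
    (h1 : proj t (q - p) < 0) (h2 : 0 < proj t (w - p)) : False := by
  have key : proj t (q - p) * coproj t (w - p) - coproj t (q - p) * proj t (w - p) = 0 := by
    rw [← cross_eq_frame, hcr]
  have hwp : w ≠ p := by
    rintro rfl
    simp [proj] at h2
  refine hwp (hp.2 hw hq ?_)
  have hpos : 0 < proj t (w - p) - proj t (q - p) := by linarith
  refine ⟨-proj t (q - p) / (proj t (w - p) - proj t (q - p)),
    proj t (w - p) / (proj t (w - p) - proj t (q - p)), div_pos (by linarith) hpos,
    div_pos h2 hpos, by field_simp; ring, ?_⟩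
  have hl : ∀ (a b : ℝ) (x y : ℂ), proj t (a • x + b • y) = a * proj t x + b * proj t y := by
    intro a b x y; simp [proj]; ring
  have hl' : ∀ (a b : ℝ) (x y : ℂ),
      coproj t (a • x + b • y) = a * coproj t x + b * coproj t y := by
    intro a b x y; simp [coproj]; ring
  apply eq_of_frame_eq (t := t)
  · rw [hl]
    field_simp
    rw [proj_sub, proj_sub]; ring
  · rw [hl']
    field_simp
    rw [proj_sub, proj_sub, coproj_sub, coproj_sub] at key
    rw [proj_sub, proj_sub]
    linear_combination -key

/-- A side that contributes to the second difference at `t` starts at a maximum of the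
projection in direction `t - e`. -/
lemma IsOrientedSide.max_fst {e t : ℝ} (he : IsFineAngle S e) {p q : ℂ}
    (hp : IsOrientedSide (newtonPolygon S) p q) (h1 : 0 < proj (t + e) (q - p))
    (h2 : 0 < proj (t - e) (p - q)) {w : ℂ} (hw : w ∈ S) : proj (t - e) w ≤ proj (t - e) p := by
  obtain ⟨hp1, hp2⟩ := hp.mem
  by_contra! hlt
  have hc := hp.cross_nonneg hw
  have hd : 0 < -proj (t - e) (q - p) := by rw [proj_sub] at h2 ⊢; linarith
  have hw1 : 0 < proj (t - e) (w - p) := by rw [proj_sub]; linarith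
  have hw2 : proj (t + e) (w - p) ≤ 0 := by
    rw [cross_eq_frame t] at hc
    rw [proj_add_angle] at h1 ⊢
    rw [proj_sub_angle] at hd hw1
    exact le_of_left_of_side he.cos_pos he.sin_pos h1 hd hc hw1
  have hpar := he.cross_eq_zero t hp1 hp2 hp1 hw
    (mul_nonpos_of_nonneg_of_nonpos h1.le (by linarith))
    (mul_nonpos_of_nonpos_of_nonneg hw2 hw1.le)
  exact not_between_of_mem_extremePoints hp.2.1 (subset_convexHull ℝ _ (by simpa using hp2))
    (subset_convexHull ℝ _ (by simpa using hw)) hpar (by linarith) hw1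

/-- A side that contributes to the second difference at `t` ends at a maximum of the
projection in direction `t + e`. -/
lemma IsOrientedSide.max_snd {e t : ℝ} (he : IsFineAngle S e) {p q : ℂ}
    (hp : IsOrientedSide (newtonPolygon S) p q) (h1 : 0 < proj (t + e) (q - p))
    (h2 : 0 < proj (t - e) (p - q)) {w : ℂ} (hw : w ∈ S) : proj (t + e) w ≤ proj (t + e) q := by
  obtain ⟨hp1, hp2⟩ := hp.mem
  by_contra! hlt
  have hc := hp.cross_nonneg hw
  have hd : 0 < -proj (t + e) (p - q) := by rw [proj_sub] at h1 ⊢; linarith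
  have hw1 : 0 < proj (t + e) (w - q) := by rw [proj_sub]; linarith
  have hw2 : proj (t - e) (w - q) ≤ 0 := by
    rw [cross_eq_frame t] at hc
    simp only [proj_add_angle, proj_sub_angle, proj_sub, coproj_sub] at *
    -- The configuration reflected in the axis of direction `t`.
    have := le_of_left_of_side he.cos_pos he.sin_pos (dx := proj t p - proj t q)
      (dy := coproj t q - coproj t p) (X := proj t w - proj t q)
      (Y := coproj t q - coproj t w) (by linarith) (by linarith) (by linarith) (by linarith)
    linarith
  have hpar := he.cross_eq_zero t hp2 hp1 hp2 hw
    (mul_nonpos_of_nonpos_of_nonneg (by linarith) h2.le)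
    (mul_nonpos_of_nonneg_of_nonpos hw1.le hw2)
  exact not_between_of_mem_extremePoints hp.2.2.1 (subset_convexHull ℝ _ (by simpa using hp1))
    (subset_convexHull ℝ _ (by simpa using hw)) hpar (by linarith) hw1

/-- If `a` and `b` are maximal in `S` in the directions `t - e` and `t + e`, but neither is
maximal in both, then `(a, b)` is a side of the Newton polygon. -/
lemma isOrientedSide_of_max {e t : ℝ} (he : IsFineAngle S e) {a b : ℂ} (ha : a ∈ S) (hb : b ∈ S)
    (hma : ∀ w ∈ S, proj (t - e) w ≤ proj (t - e) a)
    (hmb : ∀ w ∈ S, proj (t + e) w ≤ proj (t + e) b)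
    (h1 : 0 < proj (t + e) (b - a)) (h2 : 0 < proj (t - e) (a - b)) :
    IsOrientedSide (newtonPolygon S) a b := by
  have h2' : proj (t - e) (b - a) < 0 := by rw [proj_sub] at h2 ⊢; linarith
  have hne : a ≠ b := by
    rintro rfl
    simp [proj] at h1
  have hcr : ∀ w ∈ S, 0 ≤ cross (b - a) (w - a) := by
    intro w hw
    have hw1 : proj (t - e) (w - a) ≤ 0 := by rw [proj_sub]; linarith [hma w hw]
    have hpar : proj (t + e) (w - a) * proj (t - e) (w - a) ≤ 0 → cross (b - a) (w - a) = 0 :=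
      fun h ↦ he.cross_eq_zero t ha hb ha hw (mul_nonpos_of_nonneg_of_nonpos h1.le h2'.le) h
    rw [cross_eq_frame t, proj_add_angle, proj_sub_angle] at hpar
    rw [cross_eq_frame t]
    rw [proj_add_angle] at h1
    rw [proj_sub_angle] at h2' hw1
    exact cross_nonneg_of_max he.cos_pos he.sin_pos h1 (by linarith) hw1 hpar
  have hcrP : ∀ w ∈ newtonPolygon S, 0 ≤ cross (b - a) (w - a) := by
    have := le_on_newtonPolygon (S := S) (u := -(b - a).im) (v := (b - a).re)
      (k := (b - a).re * a.im - (b - a).im * a.re) (fun w hw ↦ by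
        have := hcr w hw
        simp only [cross, Complex.sub_re, Complex.sub_im] at *
        linarith)
    intro w hw
    have := this w hw
    simp only [cross, Complex.sub_re, Complex.sub_im] at *
    linarith
  have hmP : ∀ (s : ℝ) (a : ℂ), (∀ w ∈ S, proj s w ≤ proj s a) →
      ∀ w ∈ newtonPolygon S, proj s w ≤ proj s a := by
    intro s a h w hw
    have := le_on_newtonPolygon (S := S) (u := -cos s) (v := -sin s)
      (k := -proj s a) (fun w hw ↦ by have := h w hw; rw [proj_eq_re_im s w] at this; linarith) w hw
    rw [proj_eq_re_im s w]
    linarith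
  -- A point on the line through `a` and `b` is determined by its projection.
  have hdet : ∀ (s : ℝ) (c w : ℂ), proj s (b - a) ≠ 0 → proj s w = proj s c →
      cross (b - a) (w - a) = cross (b - a) (c - a) → w = c := by
    intro s c w hs hp hc
    apply eq_of_frame_eq hp
    rw [cross_eq_frame s, cross_eq_frame s, proj_sub s w, proj_sub s c, hp, coproj_sub s w,
      coproj_sub s c] at hc
    apply mul_left_cancel₀ hs
    linarith
  -- Hence `a` and `b` are the unique minima of sums of two functionals.
  have hext : ∀ (s : ℝ) (c : ℂ), c ∈ S → (∀ w ∈ S, proj s w ≤ proj s c) →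
      proj s (b - a) ≠ 0 → cross (b - a) (c - a) = 0 →
      c ∈ (newtonPolygon S).extremePoints ℝ := by
    intro s c hc hmax hs hc0
    have hf : ∀ w : ℂ, (-(b - a).im - cos s) * w.re + ((b - a).re - sin s) * w.im
        = cross (b - a) (w - a) + cross (b - a) a - proj s w := by
      intro w; simp only [cross, proj, Complex.sub_re, Complex.sub_im]; ring
    refine mem_extremePoints_of_unique_min (u := -(b - a).im - cos s) (v := (b - a).re - sin s)
      (subset_convexHull ℝ _ (by simpa using hc)) (fun w hw ↦ ?_) (fun w hw h ↦ ?_)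
    · rw [hf, hf, hc0]
      linarith [hcrP w hw, hmP s c hmax w hw]
    · rw [hf, hf, hc0] at h
      have k1 := hcrP w hw
      have k2 := hmP s c hmax w hw
      exact hdet s c w hs (by linarith) (by linarith)
  rw [isOrientedSide_iff_cross]
  refine ⟨hne, hext (t - e) a ha hma h2'.ne (by simp [cross]),
    hext (t + e) b hb hmb h1.ne' (by simp [cross]; ring), hcrP⟩

/-- The second difference of the support function is a sum of contributions of the sides: the
second derivative of the support function plus the support function itself is a sum of point
masses at the normals of the sides, of mass the lengths of the sides. -/
theorem supportFn_second_difference (hS : S.Nonempty) {e : ℝ} (he : IsFineAngle S e) (t : ℝ) :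
    supportFn S hS (t + e) + supportFn S hS (t - e) - 2 * cos e * supportFn S hS t
      = ∑ p ∈ (finite_orientedSides_newtonPolygon S).toFinset, sideKernel e t p := by
  by_cases hcom : ∃ l ∈ S, (∀ w ∈ S, proj (t + e) w ≤ proj (t + e) l) ∧
      ∀ w ∈ S, proj (t - e) w ≤ proj (t - e) l
  · obtain ⟨l, hl, h1, h2⟩ := hcom
    rw [Finset.sum_eq_zero fun p hp ↦ ?_, supportFn_eq_of_max hS hl h1,
      supportFn_eq_of_max hS hl h2, supportFn_eq_of_max hS hl, proj_add_angle, proj_sub_angle]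
    · ring
    · intro w hw
      have k1 := h1 w hw
      have k2 := h2 w hw
      rw [proj_add_angle, proj_add_angle] at k1
      rw [proj_sub_angle, proj_sub_angle] at k2
      exact le_of_mul_le_mul_left (by linarith) he.cos_pos
    · rw [Set.Finite.mem_toFinset] at hp
      exact sideKernel_eq_zero_of_common_max he hl h1 h2 hp
  obtain ⟨a, ha, hma⟩ := S.exists_max_image (proj (t - e)) hS
  obtain ⟨b, hb, hmb⟩ := S.exists_max_image (proj (t + e)) hS
  have h1 : 0 < proj (t + e) (b - a) := by
    rw [proj_sub]
    by_contra! h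
    exact hcom ⟨a, ha, fun w hw ↦ by linarith [hmb w hw], hma⟩
  have h2 : 0 < proj (t - e) (a - b) := by
    rw [proj_sub]
    by_contra! h
    exact hcom ⟨b, hb, hmb, fun w hw ↦ by linarith [hma w hw]⟩
  have hside := isOrientedSide_of_max he ha hb hma hmb h1 h2
  have hh : supportFn S hS t = proj t a + max 0 (proj t (b - a)) := by
    have hw : ∀ w ∈ S, proj t w ≤ proj t a + max 0 (proj t (b - a)) := by
      intro w hw
      have hc := hside.cross_nonneg hw
      have k1 := hma w hw
      have k2 := hmb w hw
      rw [cross_eq_frame t] at hc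
      simp only [proj_add_angle, proj_sub_angle, proj_sub, coproj_sub] at *
      have hdy : 0 < coproj t b - coproj t a := by
        have : 0 < sin e * (coproj t b - coproj t a) := by linarith
        exact (mul_pos_iff_of_pos_left he.sin_pos).mp this
      have := le_max_of_max he.cos_pos he.sin_pos (X := proj t w - proj t a)
        (Y := coproj t w - coproj t a) (dx := proj t b - proj t a)
        (dy := coproj t b - coproj t a) (by linarith) (by linarith) hc hdy
      linarith
    apply le_antisymm (Finset.sup'_le hS _ hw)
    have k1 : proj t a ≤ supportFn S hS t := Finset.le_sup' (proj t) ha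
    have k2 : proj t b ≤ supportFn S hS t := Finset.le_sup' (proj t) hb
    rw [proj_sub, ← max_add_add_left, add_zero, add_sub_cancel]
    exact max_le k1 k2
  rw [supportFn_eq_of_max hS ha hma, supportFn_eq_of_max hS hb hmb, hh,
    Finset.sum_eq_single (a, b)]
  · have h0 := he.cos_pos
    simp only [sideKernel]
    rw [max_eq_right (le_min h1.le h2.le)]
    simp only [proj_add_angle, proj_sub_angle, proj_sub]
    rcases le_total 0 (proj t b - proj t a) with h | h
    · rw [max_eq_right h, min_eq_right (by nlinarith)]; ring
    · rw [max_eq_left h, min_eq_left (by nlinarith)]; ring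
  · rintro ⟨p, q⟩ hp hne
    rw [Set.Finite.mem_toFinset] at hp
    change IsOrientedSide (newtonPolygon S) p q at hp
    rw [sideKernel, max_eq_left]
    by_contra! h
    obtain ⟨k1, k2⟩ := lt_min_iff.mp h
    obtain ⟨hp1, hq1⟩ := hp.mem
    -- Both sides start and end at maxima, so they agree.
    have main : ∀ (s : ℝ) (x y : ℂ), x ∈ S → y ∈ S → (s = t + e ∨ s = t - e) →
        proj s (b - a) ≠ 0 → proj s x = proj s y → x = y := by
      intro s x y hx hy hs hs0 hxy
      have hz : proj s (y - x) = 0 := by rw [proj_sub, hxy, sub_self]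
      have hcr := he.cross_eq_zero t ha hb hx hy
        (by rw [proj_sub] at h1 h2
            rw [proj_sub, proj_sub]
            exact mul_nonpos_of_nonneg_of_nonpos h1.le (by linarith))
        (by rcases hs with rfl | rfl <;> simp [hz])
      rw [cross_eq_frame s, hz, mul_zero, sub_zero, mul_eq_zero, or_iff_right hs0,
        coproj_sub] at hcr
      exact eq_of_frame_eq hxy (by linarith)
    apply hne
    rw [Prod.mk.injEq]
    constructor
    · refine main (t - e) p a hp1 ha (Or.inr rfl) ?_ (le_antisymm (hma p hp1)
        (hp.max_fst he k1 k2 ha))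
      rw [proj_sub] at h2 ⊢
      linarith
    · exact main (t + e) q b hq1 hb (Or.inl rfl) h1.ne' (le_antisymm (hmb q hq1)
        (hp.max_snd he k1 k2 hb))
  · intro h
    exact absurd ((finite_orientedSides_newtonPolygon S).mem_toFinset.mpr hside) h

/-! ### Cauchy's formula for the perimeter -/

lemma integral_max_zero_min_sin {e : ℝ} (h0 : 0 < e) (h1 : e < π / 2) :
    ∫ t in (-π)..π, max 0 (min (sin (t + e)) (sin (e - t))) = 2 * (1 - cos e) := by
  set G : ℝ → ℝ := fun t ↦ max 0 (min (sin (t + e)) (sin (e - t))) with hG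
  have hc : Continuous G := by fun_prop
  have hcos : 0 < cos e := cos_pos_of_mem_Ioo ⟨by linarith [pi_pos], h1⟩
  have hdiff : ∀ t, sin (t + e) - sin (e - t) = 2 * sin t * cos e := by
    intro t; rw [sin_add, sin_sub]; ring
  have hneg : ∀ t, G (-t) = G t := by
    intro t
    simp only [hG]
    rw [min_comm]
    ring_nf
  have hi : ∀ a b, IntervalIntegrable G volume a b :=
    fun a b ↦ hc.intervalIntegrable a b
  have hhalf : ∫ t in (0 : ℝ)..π, G t = 1 - cos e := by
    rw [← intervalIntegral.integral_add_adjacent_intervals (hi 0 e) (hi e π)]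
    have e1 : ∫ t in (0 : ℝ)..e, G t = ∫ t in (0 : ℝ)..e, sin (e - t) := by
      apply intervalIntegral.integral_congr
      intro t ht
      rw [Set.uIcc_of_le h0.le] at ht
      have hs : 0 ≤ sin t := sin_nonneg_of_nonneg_of_le_pi ht.1 (by linarith [ht.2, pi_pos])
      have hs' : 0 ≤ sin (e - t) :=
        sin_nonneg_of_nonneg_of_le_pi (by linarith [ht.2]) (by linarith [ht.1, pi_pos])
      have := hdiff t
      simp only [hG]
      rw [min_eq_right (by nlinarith [mul_nonneg hs hcos.le]), max_eq_right hs']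
    have e2 : ∫ t in e..π, G t = ∫ t in e..π, (0 : ℝ) := by
      apply intervalIntegral.integral_congr
      intro t ht
      rw [Set.uIcc_of_le (by linarith [pi_pos])] at ht
      have hs' : sin (e - t) ≤ 0 :=
        sin_nonpos_of_nonpos_of_neg_pi_le (by linarith [ht.1]) (by linarith [ht.2])
      exact max_eq_left ((min_le_right _ _).trans hs')
    rw [e1, e2, intervalIntegral.integral_comp_sub_left (fun x ↦ sin x)]
    simp
  rw [← intervalIntegral.integral_add_adjacent_intervals (hi (-π) 0) (hi 0 π), hhalf]
  have : ∫ t in (-π)..0, G t = ∫ t in (0 : ℝ)..π, G t := by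
    have := intervalIntegral.integral_comp_neg (a := 0) (b := π) G
    simp only [hneg, neg_zero] at this
    exact this.symm
  rw [this, hhalf]
  ring

lemma proj_eq_norm_mul_cos (t : ℝ) (v : ℂ) : proj t v = ‖v‖ * cos (t - v.arg) := by
  rw [cos_sub, proj]
  linear_combination -cos t * Complex.norm_mul_cos_arg v - sin t * Complex.norm_mul_sin_arg v

lemma integral_sideKernel {e : ℝ} (h0 : 0 < e) (h1 : e < π / 2) (p : ℂ × ℂ) :
    ∫ t in (0 : ℝ)..(2 * π), sideKernel e t p = 2 * (1 - cos e) * dist p.1 p.2 := by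
  set G : ℝ → ℝ := fun t ↦ max 0 (min (sin (t + e)) (sin (e - t))) with hG
  set φ := (p.2 - p.1).arg - π / 2 with hφ
  have hK : ∀ t, sideKernel e t p = dist p.1 p.2 * G (t - (p.2 - p.1).arg + π / 2) := by
    intro t
    have e1 : proj (t + e) (p.2 - p.1)
        = dist p.1 p.2 * sin (t - (p.2 - p.1).arg + π / 2 + e) := by
      rw [proj_eq_norm_mul_cos, dist_comm, Complex.dist_eq, ← cos_sub_pi_div_two]
      ring_nf
    have e2 : proj (t - e) (p.1 - p.2)
        = dist p.1 p.2 * sin (e - (t - (p.2 - p.1).arg + π / 2)) := by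
      have : proj (t - e) (p.1 - p.2) = - proj (t - e) (p.2 - p.1) := by
        simp only [proj_sub]; ring
      rw [this, proj_eq_norm_mul_cos, dist_comm, Complex.dist_eq,
        show e - (t - (p.2 - p.1).arg + π / 2) = -(t - e - (p.2 - p.1).arg) - π / 2 by ring,
        sin_sub_pi_div_two, cos_neg, mul_neg]
    rw [sideKernel, e1, e2, hG, mul_max_of_nonneg _ _ dist_nonneg,
      mul_min_of_nonneg _ _ dist_nonneg, mul_zero]
  have hper : Function.Periodic G (2 * π) := by
    intro t
    simp only [hG]
    rw [show t + 2 * π + e = t + e + 2 * π by ring, show e - (t + 2 * π) = e - t - 2 * π by ring,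
      sin_add_two_pi, sin_sub_two_pi]
  simp_rw [hK]
  rw [intervalIntegral.integral_const_mul, ← integral_max_zero_min_sin h0 h1]
  have : ∀ t : ℝ, t - (p.2 - p.1).arg + π / 2 = t - φ := fun t ↦ by rw [hφ]; ring
  simp_rw [this]
  rw [intervalIntegral.integral_comp_sub_right G φ, mul_comm]
  congr 1
  have := hper.intervalIntegral_add_eq (0 - φ) (-π)
  rw [show 0 - φ + 2 * π = 2 * π - φ by ring, show -π + 2 * π = π by ring] at this
  exact this

lemma continuous_supportFn (hS : S.Nonempty) : Continuous (supportFn S hS) := by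
  unfold supportFn
  apply Continuous.finset_sup'_apply
  intro v _
  unfold proj
  fun_prop

lemma supportFn_periodic (hS : S.Nonempty) : Function.Periodic (supportFn S hS) (2 * π) := by
  intro t
  simp only [supportFn, show proj (t + 2 * π) = proj t by ext v; simp [proj]]

/-- **Cauchy's formula**: the integral of the support function over all directions is the
perimeter. -/
theorem integral_supportFn (hS : S.Nonempty) :
    ∫ t in (0 : ℝ)..(2 * π), supportFn S hS t = perimeter (newtonPolygon S) := by
  obtain ⟨e, he⟩ := exists_isFineAngle S
  have hc := continuous_supportFn hS
  have hshift : ∀ a : ℝ, ∫ t in (0 : ℝ)..(2 * π), supportFn S hS (t + a)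
      = ∫ t in (0 : ℝ)..(2 * π), supportFn S hS t := by
    intro a
    rw [intervalIntegral.integral_comp_add_right (supportFn S hS) a]
    have := (supportFn_periodic hS).intervalIntegral_add_eq (0 + a) 0
    rw [show 0 + a + 2 * π = 2 * π + a by ring, zero_add (2 * π)] at this
    exact this
  have hK : ∀ p, Continuous fun t ↦ sideKernel e t p := by
    intro p
    unfold sideKernel proj
    fun_prop
  have h := intervalIntegral.integral_congr (a := 0) (b := 2 * π) (μ := volume)
    fun t _ ↦ supportFn_second_difference hS he t
  have i1 : IntervalIntegrable (fun t ↦ supportFn S hS (t + e)) volume 0 (2 * π) :=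
    (hc.comp (continuous_add_const e)).intervalIntegrable _ _
  have i2 : IntervalIntegrable (fun t ↦ supportFn S hS (t - e)) volume 0 (2 * π) :=
    (hc.comp (continuous_sub_right e)).intervalIntegrable _ _
  have i3 : IntervalIntegrable (fun t ↦ 2 * cos e * supportFn S hS t) volume
    0 (2 * π) := (hc.const_mul _).intervalIntegrable _ _
  rw [intervalIntegral.integral_sub (i1.add i2) i3, intervalIntegral.integral_add i1 i2, hshift,
    intervalIntegral.integral_const_mul] at h
  simp_rw [sub_eq_add_neg _ e] at h
  rw [hshift, intervalIntegral.integral_finsetSum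
    fun p _ ↦ (hK p).intervalIntegrable _ _] at h
  simp_rw [integral_sideKernel he.pos he.lt] at h
  rw [← Finset.mul_sum] at h
  rw [perimeter, finsum_mem_eq_finite_toFinset_sum _ (finite_orientedSides_newtonPolygon S)]
  have hlt : cos e < 1 := by
    have := cos_lt_cos_of_nonneg_of_le_pi_div_two le_rfl he.lt.le he.pos
    simpa using this
  have hne : (2 * (1 - cos e)) ≠ 0 := by
    have : 0 < 2 * (1 - cos e) := by linarith
    exact this.ne'
  apply mul_left_cancel₀ hne
  linarith

/-! ### Jensen's formula for entire functions -/

section Jensen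

variable {f : ℂ → ℂ}

lemma analyticOrderAt_ne_top_of_entire (hf : Differentiable ℂ f) {z₀ : ℂ} (hz₀ : f z₀ ≠ 0)
    (z : ℂ) : analyticOrderAt f z ≠ ⊤ := by
  have hA : AnalyticOnNhd ℂ f Set.univ := fun w _ ↦ hf.analyticAt w
  refine hA.analyticOrderAt_ne_top_of_isPreconnected isPreconnected_univ (Set.mem_univ z₀)
    (Set.mem_univ z) ?_
  rw [(hf.analyticAt z₀).analyticOrderAt_eq_zero.mpr hz₀]
  simp

lemma divisor_eq_analyticOrderNatAt (hf : Differentiable ℂ f) {z₀ : ℂ} (hz₀ : f z₀ ≠ 0)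
    {U : Set ℂ} {z : ℂ} (hz : z ∈ U) :
    MeromorphicOn.divisor f U z = (analyticOrderNatAt f z : ℤ) := by
  rw [MeromorphicOn.AnalyticOnNhd.divisor_apply (fun w _ ↦ hf.analyticAt w) hz,
    ← Nat.cast_analyticOrderNatAt (analyticOrderAt_ne_top_of_entire hf hz₀ z)]
  simp

lemma analyticOrderNatAt_ne_zero_iff (hf : Differentiable ℂ f) {z₀ : ℂ} (hz₀ : f z₀ ≠ 0)
    {z : ℂ} : analyticOrderNatAt f z ≠ 0 ↔ f z = 0 := by
  rw [← (hf.analyticAt z).analyticOrderAt_ne_zero,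
    ← Nat.cast_analyticOrderNatAt (analyticOrderAt_ne_top_of_entire hf hz₀ z)]
  simp

lemma finite_zeros_closedBall (hf : Differentiable ℂ f) {z₀ : ℂ} (hz₀ : f z₀ ≠ 0) (R : ℝ) :
    {z ∈ Metric.closedBall (0 : ℂ) R | f z = 0}.Finite := by
  refine ((MeromorphicOn.divisor f (Metric.closedBall 0 R)).finiteSupport
    (isCompact_closedBall 0 R)).subset ?_
  rintro z ⟨hz, h0⟩
  rw [Function.mem_support, divisor_eq_analyticOrderNatAt hf hz₀ hz]
  exact_mod_cast (analyticOrderNatAt_ne_zero_iff hf hz₀).mpr h0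

lemma finite_zerosInDisk (hf : Differentiable ℂ f) {z₀ : ℂ} (hz₀ : f z₀ ≠ 0) (r : ℝ) :
    (zerosInDisk f r).Finite :=
  (finite_zeros_closedBall hf hz₀ r).subset fun _ hz ↦ ⟨Metric.ball_subset_closedBall hz.1, hz.2⟩

/-- The weight of a zero `z` in Jensen's formula for the circle of radius `R`. At `z = 0` it is
`log R`, by the convention `log 0 = 0`. -/
def jensenWeight (R : ℝ) (z : ℂ) : ℝ := if ‖z‖ ≤ R then log R - log ‖z‖ else 0

/-- **Jensen's formula** for an entire function, as a sum over any finite set `Z` that contains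
all zeros in the closed disk. -/
lemma circleAverage_log_norm_eq_sum (hf : Differentiable ℂ f) {z₀ : ℂ} (hz₀ : f z₀ ≠ 0) {R : ℝ}
    (hR : 0 < R) {Z : Finset ℂ} (hZ : ∀ z, ‖z‖ ≤ R → f z = 0 → z ∈ Z) :
    circleAverage (fun z ↦ log ‖f z‖) 0 R
      = ∑ z ∈ Z, analyticOrderNatAt f z * jensenWeight R z
        + log ‖meromorphicTrailingCoeffAt f 0‖ := by
  rw [MeromorphicOn.circleAverage_log_norm hR.ne' fun z _ ↦ (hf.analyticAt z).meromorphicAt]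
  rw [abs_of_pos hR]
  set D := MeromorphicOn.divisor f (Metric.closedBall 0 R)
  rw [← countingFunction_finsum_eq_finsum_add hR.ne'
    (D.finiteSupport (isCompact_closedBall 0 R))]
  congr 1
  have hD : ∀ z, (D z : ℝ) * (log R - log ‖0 - z‖)
      = analyticOrderNatAt f z * jensenWeight R z := by
    intro z
    by_cases hz : ‖z‖ ≤ R
    · rw [divisor_eq_analyticOrderNatAt hf hz₀ (by simpa using hz)]
      simp [jensenWeight, hz]
    · rw [D.apply_eq_zero_of_notMem (by simpa using hz)]
      simp [jensenWeight, hz]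
  simp_rw [hD]
  apply finsum_eq_sum_of_support_subset
  intro z hz
  rw [Function.mem_support, mul_ne_zero_iff] at hz
  have h1 : ‖z‖ ≤ R := by
    by_contra h
    simp [jensenWeight, h] at hz
  exact hZ z h1 ((analyticOrderNatAt_ne_zero_iff hf hz₀).mp (by exact_mod_cast hz.1))

lemma jensenWeight_sub_mem {s₁ s₂ : ℝ} (h1 : 0 < s₁) (h12 : s₁ ≤ s₂) (z : ℂ) :
    0 ≤ jensenWeight s₂ z - jensenWeight s₁ z ∧
      jensenWeight s₂ z - jensenWeight s₁ z ≤ log s₂ - log s₁ := by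
  have hlog := log_le_log h1 h12
  unfold jensenWeight
  split_ifs with h2 h3 h3
  · constructor <;> linarith
  · have k1 := log_le_log h1 (not_le.mp h3).le
    have k2 := log_le_log (h1.trans (not_le.mp h3)) h2
    constructor <;> linarith
  · exact absurd (h3.trans h12) h2
  · constructor <;> linarith

lemma zeroCount_eq_sum (hf : Differentiable ℂ f) {z₀ : ℂ} (hz₀ : f z₀ ≠ 0) (r : ℝ) :
    zeroCount f r = ∑ z ∈ (finite_zerosInDisk hf hz₀ r).toFinset, analyticOrderNatAt f z :=
  finsum_mem_eq_finite_toFinset_sum _ _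

lemma zeroCount_mono (hf : Differentiable ℂ f) {z₀ : ℂ} (hz₀ : f z₀ ≠ 0) {r s : ℝ}
    (hrs : r ≤ s) : zeroCount f r ≤ zeroCount f s := by
  rw [zeroCount_eq_sum hf hz₀, zeroCount_eq_sum hf hz₀]
  refine Finset.sum_le_sum_of_subset fun z hz ↦ ?_
  rw [Set.Finite.mem_toFinset] at hz ⊢
  exact ⟨Metric.ball_subset_ball hrs hz.1, hz.2⟩

lemma circleAverage_log_norm_sub (hf : Differentiable ℂ f) {z₀ : ℂ} (hz₀ : f z₀ ≠ 0)
    {s₁ s₂ : ℝ} (h1 : 0 < s₁) (h12 : s₁ ≤ s₂) :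
    circleAverage (fun z ↦ log ‖f z‖) 0 s₂ - circleAverage (fun z ↦ log ‖f z‖) 0 s₁
      = ∑ z ∈ (finite_zeros_closedBall hf hz₀ s₂).toFinset,
        analyticOrderNatAt f z * (jensenWeight s₂ z - jensenWeight s₁ z) := by
  rw [circleAverage_log_norm_eq_sum hf hz₀ (h1.trans_le h12)
      (Z := (finite_zeros_closedBall hf hz₀ s₂).toFinset)
      (fun z hz h0 ↦ by simpa using ⟨hz, h0⟩),
    circleAverage_log_norm_eq_sum hf hz₀ h1
      (Z := (finite_zeros_closedBall hf hz₀ s₂).toFinset)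
      (fun z hz h0 ↦ by simpa using ⟨hz.trans h12, h0⟩)]
  simp_rw [mul_sub]
  rw [Finset.sum_sub_distrib]
  ring

lemma zeroCount_mul_log_le (hf : Differentiable ℂ f) {z₀ : ℂ} (hz₀ : f z₀ ≠ 0)
    {s₁ s₂ r : ℝ} (h1 : 0 < s₁) (h12 : s₁ ≤ s₂) (hr : r ≤ s₁) :
    zeroCount f r * (log s₂ - log s₁) ≤
      circleAverage (fun z ↦ log ‖f z‖) 0 s₂ - circleAverage (fun z ↦ log ‖f z‖) 0 s₁ := by
  rw [circleAverage_log_norm_sub hf hz₀ h1 h12, zeroCount_eq_sum hf hz₀, Nat.cast_sum,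
    Finset.sum_mul]
  calc _ = ∑ z ∈ (finite_zerosInDisk hf hz₀ r).toFinset,
        analyticOrderNatAt f z * (jensenWeight s₂ z - jensenWeight s₁ z) := by
        refine Finset.sum_congr rfl fun z hz ↦ ?_
        rw [Set.Finite.mem_toFinset] at hz
        have hz1 : ‖z‖ ≤ s₁ := (mem_ball_zero_iff.mp hz.1).le.trans hr
        simp [jensenWeight, hz1, hz1.trans h12]
    _ ≤ _ := by
        refine Finset.sum_le_sum_of_subset_of_nonneg (fun z hz ↦ ?_) fun z _ _ ↦
          mul_nonneg (Nat.cast_nonneg _) (jensenWeight_sub_mem h1 h12 z).1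
        rw [Set.Finite.mem_toFinset] at hz ⊢
        exact ⟨Metric.ball_subset_closedBall (Metric.ball_subset_ball (hr.trans h12) hz.1), hz.2⟩

lemma le_zeroCount_mul_log (hf : Differentiable ℂ f) {z₀ : ℂ} (hz₀ : f z₀ ≠ 0)
    {s₁ s₂ r : ℝ} (h1 : 0 < s₁) (h12 : s₁ ≤ s₂) (hr : s₂ < r) :
    circleAverage (fun z ↦ log ‖f z‖) 0 s₂ - circleAverage (fun z ↦ log ‖f z‖) 0 s₁
      ≤ zeroCount f r * (log s₂ - log s₁) := by
  rw [circleAverage_log_norm_sub hf hz₀ h1 h12, zeroCount_eq_sum hf hz₀, Nat.cast_sum,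
    Finset.sum_mul]
  calc _ ≤ ∑ z ∈ (finite_zeros_closedBall hf hz₀ s₂).toFinset,
        analyticOrderNatAt f z * (log s₂ - log s₁) :=
        Finset.sum_le_sum fun z _ ↦ mul_le_mul_of_nonneg_left
          (jensenWeight_sub_mem h1 h12 z).2 (Nat.cast_nonneg _)
    _ ≤ _ := by
        refine Finset.sum_le_sum_of_subset_of_nonneg (fun z hz ↦ ?_) fun z _ _ ↦
          mul_nonneg (Nat.cast_nonneg _) (sub_nonneg.mpr (log_le_log h1 h12))
        rw [Set.Finite.mem_toFinset] at hz ⊢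
        exact ⟨Metric.closedBall_subset_ball hr hz.1, hz.2⟩

/-- The mean value inequality for the subharmonic function `log ‖f‖`. -/
lemma log_norm_le_circleAverage (hf : Differentiable ℂ f) {p : ℂ} (hp : f p ≠ 0) {R : ℝ}
    (hR : 0 < R) : log ‖f p‖ ≤ circleAverage (fun z ↦ log ‖f z‖) p R := by
  rw [AnalyticOnNhd.circleAverage_log_norm hR.ne' (fun z _ ↦ hf.analyticAt z) hp, abs_of_pos hR]
  have : 0 ≤ ∑ᶠ u, (MeromorphicOn.divisor f (Metric.closedBall p R) u : ℝ)
      * log (R * ‖p - u‖⁻¹) := by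
    refine finsum_nonneg fun u ↦ ?_
    by_cases hu : u ∈ Metric.closedBall p R
    · refine mul_nonneg ?_ ?_
      · rw [divisor_eq_analyticOrderNatAt hf hp hu]
        positivity
      · rcases eq_or_ne p u with rfl | hne
        · simp
        apply log_nonneg
        rw [← div_eq_mul_inv, one_le_div (norm_pos_iff.mpr (sub_ne_zero.mpr hne)),
          ← dist_eq_norm, dist_comm]
        exact hu
    · rw [Function.locallyFinsuppWithin.apply_eq_zero_of_notMem _ hu]
      simp
  linarith

end Jensen

/-! ### Comparison of an exponential sum with its largest term -/

/-- The Euclidean scalar product of the plane, `Re (conj l * z)`. -/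
def dot (l z : ℂ) : ℝ := l.re * z.re + l.im * z.im

lemma dot_sub_left (l m z : ℂ) : dot (l - m) z = dot l z - dot m z := by
  simp [dot]; ring

lemma dot_sub_right (l z w : ℂ) : dot l (z - w) = dot l z - dot l w := by
  simp [dot]; ring

lemma abs_dot_le (l z : ℂ) : |dot l z| ≤ ‖l‖ * ‖z‖ := by
  have h : dot l z = ((starRingEnd ℂ) l * z).re := by simp [dot]
  rw [h]
  refine (Complex.abs_re_le_norm _).trans ?_
  simp

lemma dot_circleMap (l : ℂ) (s t : ℝ) : dot l (circleMap 0 s t) = s * proj t l := by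
  simp [dot, proj, circleMap_zero_re, circleMap_zero_im]; ring

lemma norm_exp_conj_mul (l z : ℂ) : ‖Complex.exp ((starRingEnd ℂ) l * z)‖ = exp (dot l z) := by
  rw [Complex.norm_exp]; simp [dot]

/-- The logarithm of the largest absolute value of a term of the exponential sum at `z`. -/
def logMaxTerm (S : Finset ℂ) (hS : S.Nonempty) (c : ℂ → ℂ) (z : ℂ) : ℝ :=
  S.sup' hS fun l ↦ log ‖c l‖ + dot l z

/-- A majorant of the ratio of the sum of all other terms to the largest term of an exponential
sum, when `k` bounds all ratios of coefficients; see `abs_log_sub_logMaxTerm_le`. It decays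
exponentially away from the lines orthogonal to the differences of the spectrum. -/
def tailBound (S : Finset ℂ) (k : ℝ) (z : ℂ) : ℝ :=
  ∑ p ∈ S.offDiag, k * exp (-|dot (p.1 - p.2) z|)

variable {c : ℂ → ℂ}

lemma differentiable_expSum : Differentiable ℂ (expSum S c) := by
  unfold expSum
  fun_prop

lemma continuous_logMaxTerm (hS : S.Nonempty) : Continuous (logMaxTerm S hS c) := by
  unfold logMaxTerm
  apply Continuous.finset_sup'_apply
  intro v _
  unfold dot
  fun_prop

lemma continuous_tailBound (k : ℝ) : Continuous (tailBound S k) := by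
  unfold tailBound dot
  fun_prop

lemma exists_logMaxTerm_eq (hS : S.Nonempty) (c : ℂ → ℂ) (z : ℂ) : ∃ v ∈ S,
    logMaxTerm S hS c z = log ‖c v‖ + dot v z ∧
      ∀ l ∈ S, log ‖c l‖ + dot l z ≤ log ‖c v‖ + dot v z := by
  obtain ⟨v, hv, hmax⟩ := S.exists_max_image (fun l ↦ log ‖c l‖ + dot l z) hS
  exact ⟨v, hv, le_antisymm (Finset.sup'_le hS _ hmax)
    (Finset.le_sup' (fun l ↦ log ‖c l‖ + dot l z) hv), hmax⟩

lemma le_logMaxTerm (hS : S.Nonempty) {l : ℂ} (hl : l ∈ S) (z : ℂ) :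
    log ‖c l‖ + dot l z ≤ logMaxTerm S hS c z :=
  Finset.le_sup' (fun l ↦ log ‖c l‖ + dot l z) hl

lemma abs_logMaxTerm_sub_le (hS : S.Nonempty) (c : ℂ → ℂ) (z w : ℂ) :
    |logMaxTerm S hS c z - logMaxTerm S hS c w| ≤ (∑ l ∈ S, ‖l‖) * ‖z - w‖ := by
  have key : ∀ z w, logMaxTerm S hS c z ≤ logMaxTerm S hS c w + (∑ l ∈ S, ‖l‖) * ‖z - w‖ := by
    intro z w
    refine Finset.sup'_le hS _ fun l hl ↦ ?_
    have h1 := le_logMaxTerm (c := c) hS hl w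
    have h2 := (abs_dot_le l (z - w))
    have h3 : ‖l‖ * ‖z - w‖ ≤ (∑ l ∈ S, ‖l‖) * ‖z - w‖ := by
      gcongr
      exact Finset.single_le_sum (f := fun l : ℂ ↦ ‖l‖) (fun _ _ ↦ norm_nonneg _) hl
    rw [dot_sub_right] at h2
    linarith [le_abs_self (dot l z - dot l w)]
  rw [abs_le]
  have h1 := key z w
  have h2 := key w z
  rw [norm_sub_rev w z] at h2
  constructor <;> linarith

lemma norm_term_eq (hc : ∀ l ∈ S, c l ≠ 0) {l : ℂ} (hl : l ∈ S) (z : ℂ) :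
    ‖c l * Complex.exp ((starRingEnd ℂ) l * z)‖ = exp (log ‖c l‖ + dot l z) := by
  rw [norm_mul, norm_exp_conj_mul, exp_add, exp_log (norm_pos_iff.mpr (hc l hl))]

lemma norm_expSum_le (hS : S.Nonempty) (hc : ∀ l ∈ S, c l ≠ 0) (z : ℂ) :
    ‖expSum S c z‖ ≤ exp (log S.card + logMaxTerm S hS c z) := by
  have hn : (0 : ℝ) < S.card := by exact_mod_cast hS.card_pos
  rw [exp_add, exp_log hn, ← nsmul_eq_mul]
  refine (norm_sum_le _ _).trans (Finset.sum_le_card_nsmul _ _ _ fun l hl ↦ ?_)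
  rw [norm_term_eq hc hl]
  exact exp_le_exp.mpr (le_logMaxTerm hS hl z)

lemma abs_log_norm_one_add_le {x : ℂ} {q : ℝ} (hx : ‖x‖ ≤ q) (hq : q ≤ 1 / 2) :
    |log ‖1 + x‖| ≤ 2 * q := by
  have h1 : ‖1 + x‖ ≤ 1 + q := (norm_add_le _ _).trans (by simpa using hx)
  have h2 : 1 - q ≤ ‖1 + x‖ := by
    have := norm_sub_norm_le (1 : ℂ) (-x)
    simp only [norm_one, norm_neg, sub_neg_eq_add] at this
    linarith
  have hq0 : 0 ≤ q := (norm_nonneg x).trans hx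
  have hpos : 0 < ‖1 + x‖ := by linarith
  rw [abs_le]
  constructor
  · have h3 := one_sub_inv_le_log_of_pos hpos
    have h4 : ‖1 + x‖⁻¹ ≤ 1 + 2 * q := by
      rw [inv_le_iff_one_le_mul₀ hpos]
      nlinarith
    linarith
  · have := log_le_sub_one_of_pos hpos
    linarith

/-- Where the tail is small, the exponential sum is comparable with its largest term. -/
theorem abs_log_sub_logMaxTerm_le (hS : S.Nonempty) (hc : ∀ l ∈ S, c l ≠ 0) {k : ℝ}
    (hk : ∀ l ∈ S, ∀ m ∈ S, log ‖c l‖ - log ‖c m‖ ≤ log k) (hk0 : 0 < k) {z : ℂ}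
    (hz : tailBound S k z ≤ 1 / 2) :
    expSum S c z ≠ 0 ∧
      |log ‖expSum S c z‖ - logMaxTerm S hS c z| ≤ 2 * tailBound S k z := by
  obtain ⟨v, hv, hmv, hmax⟩ := exists_logMaxTerm_eq hS c z
  set a : ℂ → ℂ := fun l ↦ c l * Complex.exp ((starRingEnd ℂ) l * z) with ha
  have hav : a v ≠ 0 := mul_ne_zero (hc v hv) (Complex.exp_ne_zero _)
  set x : ℂ := (∑ l ∈ S.erase v, a l) / a v with hx
  have hsum : expSum S c z = a v * (1 + x) := by
    rw [hx, mul_add, mul_div_cancel₀ _ hav, mul_one, Finset.add_sum_erase S a hv]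
    rfl
  have hxq : ‖x‖ ≤ tailBound S k z := by
    have h1 : ‖x‖ ≤ ∑ l ∈ S.erase v, k * exp (-|dot (l - v) z|) := by
      rw [hx, Finset.sum_div]
      refine (norm_sum_le _ _).trans (Finset.sum_le_sum fun l hl ↦ ?_)
      have hlS := Finset.mem_of_mem_erase hl
      rw [norm_div, norm_term_eq hc hlS, norm_term_eq hc hv, ← exp_sub]
      nth_rw 1 [← exp_log hk0]
      rw [← exp_add, exp_le_exp, dot_sub_left]
      have h2 := hmax l hlS
      have h3 := hk v hv l hlS
      have h4 := hk l hlS v hv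
      rcases abs_cases (dot l z - dot v z) with ⟨h, _⟩ | ⟨h, _⟩ <;> rw [h] <;> linarith
    refine h1.trans ?_
    rw [tailBound, ← Finset.sum_image (g := fun l : ℂ ↦ (l, v))
      (f := fun p : ℂ × ℂ ↦ k * exp (-|dot (p.1 - p.2) z|)) (by intro _ _ _ _ h; simpa using h)]
    refine Finset.sum_le_sum_of_subset_of_nonneg (fun p hp ↦ ?_) fun _ _ _ ↦ by positivity
    obtain ⟨l, hl, rfl⟩ := Finset.mem_image.mp hp
    exact Finset.mem_offDiag.mpr ⟨Finset.mem_of_mem_erase hl, hv, Finset.ne_of_mem_erase hl⟩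
  have hx1 : 1 + x ≠ 0 := by
    intro h
    have : ‖x‖ = 1 := by rw [show x = -1 by linear_combination h]; simp
    linarith
  refine ⟨by rw [hsum]; exact mul_ne_zero hav hx1, ?_⟩
  rw [hsum, norm_mul, log_mul (norm_ne_zero_iff.mpr hav) (norm_ne_zero_iff.mpr hx1), hmv,
    norm_term_eq hc hv, log_exp, add_sub_cancel_left]
  exact abs_log_norm_one_add_le hxq hz

lemma exists_coeff_ratio_bound (S : Finset ℂ) (c : ℂ → ℂ) :
    ∃ k : ℝ, 0 < k ∧ 0 ≤ log k ∧ ∀ l ∈ S, ∀ m ∈ S, log ‖c l‖ - log ‖c m‖ ≤ log k := by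
  refine ⟨exp (∑ l ∈ S, |log ‖c l‖| + ∑ l ∈ S, |log ‖c l‖|), exp_pos _, ?_, fun l hl m hm ↦ ?_⟩
  · rw [log_exp]
    positivity
  · rw [log_exp]
    have h1 := Finset.single_le_sum (f := fun l ↦ |log ‖c l‖|) (fun _ _ ↦ abs_nonneg _) hl
    have h2 := Finset.single_le_sum (f := fun l ↦ |log ‖c l‖|) (fun _ _ ↦ abs_nonneg _) hm
    have h3 := le_abs_self (log ‖c l‖)
    have h4 := neg_abs_le (log ‖c m‖)
    linarith

/-- The function `logMaxTerm` grows along rays as the support function of the spectrum, up to a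
small relative error. -/
lemma abs_logMaxTerm_ray_sub_le (hS : S.Nonempty) {k : ℝ}
    (hk : ∀ l ∈ S, ∀ m ∈ S, log ‖c l‖ - log ‖c m‖ ≤ log k) (hk0 : 0 ≤ log k) {s₁ s₂ : ℝ}
    (h1 : 0 < s₁) (h12 : s₁ ≤ s₂) (t : ℝ) :
    |logMaxTerm S hS c (circleMap 0 s₂ t) - logMaxTerm S hS c (circleMap 0 s₁ t)
      - (s₂ - s₁) * supportFn S hS t| ≤ (s₂ - s₁) * (log k / s₁) := by
  have h0 : 0 ≤ s₂ - s₁ := sub_nonneg.mpr h12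
  have hle : ∀ l ∈ S, proj t l ≤ supportFn S hS t := fun l hl ↦ Finset.le_sup' (proj t) hl
  rw [abs_le]
  constructor
  · obtain ⟨l, hl, hml, hmax⟩ := exists_logMaxTerm_eq hS c (circleMap 0 s₁ t)
    obtain ⟨v, hv, hmv⟩ := S.exists_max_image (proj t) hS
    have hv' := supportFn_eq_of_max hS hv hmv
    have h2 := le_logMaxTerm (c := c) hS hl (circleMap 0 s₂ t)
    have h3 := hmax v hv
    have h4 := hk l hl v hv
    rw [dot_circleMap] at hml h2
    rw [dot_circleMap, dot_circleMap] at h3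
    have h5 : supportFn S hS t - proj t l ≤ log k / s₁ := by
      rw [le_div_iff₀ h1, hv']
      linarith
    have h6 := mul_le_mul_of_nonneg_left h5 h0
    rw [hml]
    linarith
  · have h2 : logMaxTerm S hS c (circleMap 0 s₂ t)
        ≤ logMaxTerm S hS c (circleMap 0 s₁ t) + (s₂ - s₁) * supportFn S hS t := by
      refine Finset.sup'_le hS _ fun l hl ↦ ?_
      have h3 := le_logMaxTerm (c := c) hS hl (circleMap 0 s₁ t)
      have h4 := mul_le_mul_of_nonneg_left (hle l hl) h0
      rw [dot_circleMap] at h3 ⊢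
      linarith
    have : 0 ≤ (s₂ - s₁) * (log k / s₁) := by positivity
    linarith

lemma circleAverage_logMaxTerm_sub (hS : S.Nonempty) {k : ℝ}
    (hk : ∀ l ∈ S, ∀ m ∈ S, log ‖c l‖ - log ‖c m‖ ≤ log k) (hk0 : 0 ≤ log k) {s₁ s₂ : ℝ}
    (h1 : 0 < s₁) (h12 : s₁ ≤ s₂) :
    |circleAverage (logMaxTerm S hS c) 0 s₂ - circleAverage (logMaxTerm S hS c) 0 s₁
      - (s₂ - s₁) * (perimeter (newtonPolygon S) / (2 * π))| ≤ (s₂ - s₁) * (log k / s₁) := by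
  have hH := continuous_logMaxTerm (c := c) hS
  have hi : ∀ s : ℝ, IntervalIntegrable (fun t ↦ logMaxTerm S hS c (circleMap 0 s t))
      volume 0 (2 * π) := fun s ↦
    (hH.comp (continuous_circleMap 0 s)).intervalIntegrable _ _
  have hi' : IntervalIntegrable (fun t ↦ (s₂ - s₁) * supportFn S hS t)
      volume 0 (2 * π) :=
    ((continuous_supportFn hS).const_mul _).intervalIntegrable _ _
  have hb := intervalIntegral.norm_integral_le_of_norm_le_const (a := 0) (b := 2 * π)
    fun t _ ↦ (norm_eq_abs _).trans_le (abs_logMaxTerm_ray_sub_le hS hk hk0 h1 h12 t)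
  rw [intervalIntegral.integral_sub ((hi s₂).sub (hi s₁)) hi',
    intervalIntegral.integral_sub (hi s₂) (hi s₁), intervalIntegral.integral_const_mul,
    integral_supportFn hS, sub_zero, norm_eq_abs, abs_of_pos two_pi_pos] at hb
  have heq : circleAverage (logMaxTerm S hS c) 0 s₂ - circleAverage (logMaxTerm S hS c) 0 s₁
      - (s₂ - s₁) * (perimeter (newtonPolygon S) / (2 * π))
      = (2 * π)⁻¹ * ((∫ t in (0 : ℝ)..(2 * π), logMaxTerm S hS c (circleMap 0 s₂ t))
        - (∫ t in (0 : ℝ)..(2 * π), logMaxTerm S hS c (circleMap 0 s₁ t))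
        - (s₂ - s₁) * perimeter (newtonPolygon S)) := by
    simp only [circleAverage_def, smul_eq_mul]
    ring
  rw [heq, abs_mul, abs_of_pos (inv_pos.mpr two_pi_pos), inv_mul_le_iff₀ two_pi_pos]
  linarith

lemma exists_dot_ne_zero (T : Finset ℂ) (hT : ∀ d ∈ T, d ≠ 0) :
    ∃ w : ℂ, ∀ d ∈ T, dot d w ≠ 0 := by
  obtain ⟨t, ht⟩ := Infinite.exists_notMem_finset (T.image fun d ↦ -d.re / d.im)
  refine ⟨⟨1, t⟩, fun d hd h ↦ ?_⟩
  simp only [dot, mul_one] at h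
  by_cases him : d.im = 0
  · exact hT d hd (Complex.ext (by simpa [him] using h) him)
  · refine ht (Finset.mem_image.mpr ⟨d, hd, ?_⟩)
    field_simp
    linarith

/-- Every point of the plane has at bounded distance a point that is far from all the lines
orthogonal to the vectors in a given finite set. -/
lemma exists_near_le_abs_dot (T : Finset ℂ) (hT : ∀ d ∈ T, d ≠ 0) (K : ℝ) :
    ∃ R : ℝ, 0 < R ∧ ∀ p : ℂ, ∃ p' : ℂ, ‖p' - p‖ ≤ R ∧ ∀ d ∈ T, K ≤ |dot d p'| := by
  obtain ⟨w, hw⟩ := exists_dot_ne_zero T hT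
  obtain ⟨q, hq0, hq⟩ : ∃ q : ℝ, 0 < q ∧ ∀ d ∈ T, 2 * K ≤ q * |dot d w| := by
    refine ⟨1 + ∑ d ∈ T, 2 * |K| / |dot d w|, by positivity, fun d hd ↦ ?_⟩
    have h1 := Finset.single_le_sum (f := fun d ↦ 2 * |K| / |dot d w|)
      (fun _ _ ↦ by positivity) hd
    have hpos : 0 < |dot d w| := abs_pos.mpr (hw d hd)
    have h2 : 2 * |K| / |dot d w| * |dot d w| = 2 * |K| := div_mul_cancel₀ _ hpos.ne'
    nlinarith [le_abs_self K]
  refine ⟨(T.card + 1) * q * (‖w‖ + 1), by positivity, fun p ↦ ?_⟩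
  -- Among `T.card + 1` equidistant points on a line, each vector of `T` excludes at most one.
  by_contra! hbad
  have hbad' : ∀ j ∈ Finset.range (T.card + 1), ∃ d ∈ T,
      |dot d (p + ((j : ℝ) * q : ℝ) * w)| < K := by
    intro j hj
    apply hbad
    rw [add_sub_cancel_left, norm_mul, Complex.norm_real, norm_of_nonneg (by positivity)]
    have : (j : ℝ) ≤ T.card + 1 := by
      have := (Finset.mem_range.mp hj).le
      exact_mod_cast this
    gcongr
    linarith
  choose! d hd hdK using hbad'
  obtain ⟨i, hi, j, hj, hne, hij⟩ := Finset.exists_ne_map_eq_of_card_lt_of_maps_to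
    (by simp) (fun j hj ↦ hd j hj : Set.MapsTo d (Finset.range (T.card + 1)) T)
  have h1 := hdK i hi
  have h2 := hdK j hj
  rw [← hij] at h2
  have hlin : ∀ j : ℕ, dot (d i) (p + ((j : ℝ) * q : ℝ) * w)
      = dot (d i) p + j * (q * dot (d i) w) := by
    intro j; simp [dot]; ring
  rw [hlin] at h1 h2
  have h3 := hq (d i) (hd i hi)
  have h4 : (1 : ℝ) ≤ |(i : ℝ) - j| := by
    have : (1 : ℤ) ≤ |(i : ℤ) - j| := Int.one_le_abs (sub_ne_zero.mpr (by exact_mod_cast hne))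
    exact_mod_cast this
  have h5 : |((i : ℝ) - j) * (q * dot (d i) w)| < 2 * K := by
    have := abs_sub (dot (d i) p + i * (q * dot (d i) w)) (dot (d i) p + j * (q * dot (d i) w))
    rw [show ((i : ℝ) - j) * (q * dot (d i) w) = (dot (d i) p + i * (q * dot (d i) w))
      - (dot (d i) p + j * (q * dot (d i) w)) by ring]
    linarith
  rw [abs_mul, abs_mul, abs_of_pos hq0] at h5
  have h6 := mul_le_mul_of_nonneg_right h4 (mul_nonneg hq0.le (abs_nonneg (dot (d i) w)))
  linarith

/-- The tail is small at all points that are far from the lines orthogonal to the differences of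
the spectrum. -/
lemma exists_tailBound_le_half (S : Finset ℂ) {k : ℝ} (hk0 : 0 < k) :
    ∃ K : ℝ, ∀ z, (∀ p ∈ S.offDiag, K ≤ |dot (p.1 - p.2) z|) → tailBound S k z ≤ 1 / 2 := by
  refine ⟨log (2 * S.offDiag.card * k + 1), fun z hz ↦ ?_⟩
  have hpos : 0 < 2 * (S.offDiag.card : ℝ) * k + 1 := by positivity
  calc tailBound S k z ≤ ∑ p ∈ S.offDiag, k * (2 * S.offDiag.card * k + 1)⁻¹ := by
        refine Finset.sum_le_sum fun p hp ↦ ?_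
        gcongr
        rw [← exp_log (inv_pos.mpr hpos), log_inv]
        exact exp_le_exp.mpr (neg_le_neg (hz p hp))
    _ ≤ 1 / 2 := by
        rw [Finset.sum_const, nsmul_eq_mul, ← div_eq_mul_inv, mul_div_assoc', div_le_iff₀ hpos]
        linarith

lemma exists_near_tailBound_le_half (S : Finset ℂ) {k : ℝ} (hk0 : 0 < k) :
    ∃ R : ℝ, 0 < R ∧ ∀ p : ℂ, ∃ p' : ℂ, ‖p' - p‖ ≤ R ∧ tailBound S k p' ≤ 1 / 2 := by
  obtain ⟨K, hK⟩ := exists_tailBound_le_half S hk0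
  obtain ⟨R, hR, h⟩ := exists_near_le_abs_dot (S.offDiag.image fun p ↦ p.1 - p.2)
    (by simp only [Finset.mem_image, Finset.mem_offDiag]
        rintro _ ⟨p, ⟨-, -, hne⟩, rfl⟩
        exact sub_ne_zero.mpr hne) K
  refine ⟨R, hR, fun p ↦ ?_⟩
  obtain ⟨p', h1, h2⟩ := h p
  exact ⟨p', h1, hK p' fun x hx ↦ h2 _ (Finset.mem_image_of_mem _ hx)⟩

/-! ### Integration in polar coordinates -/

/-- Integration in polar coordinates over a rotationally symmetric set centered at `p`. -/
lemma setLIntegral_eq_polar {g : ℂ → ENNReal} (hg : Measurable g) {I : Set ℝ}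
    (hI : MeasurableSet I) (p : ℂ) :
    ∫⁻ z in {z | ‖z - p‖ ∈ I}, g z = ∫⁻ ρ in I ∩ Set.Ioi 0,
      ENNReal.ofReal ρ * ∫⁻ θ in Set.Ioo (-π) π, g (circleMap p ρ θ) := by
  have hA : MeasurableSet {z : ℂ | ‖z - p‖ ∈ I} :=
    (measurable_norm.comp (measurable_id.sub_const p)) hI
  have hcm : Measurable fun x : ℝ × ℝ ↦ g (circleMap p x.1 x.2) := by
    refine hg.comp (Continuous.measurable ?_)
    simp only [circleMap]
    fun_prop
  rw [← lintegral_indicator hA, ← lintegral_add_right_eq_self _ p,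
    ← Complex.lintegral_comp_polarCoord_symm, polarCoord_target, Measure.volume_eq_prod,
    ← Measure.prod_restrict]
  have hkey : ∀ x ∈ Set.Ioi (0 : ℝ), ∀ θ : ℝ, {z : ℂ | ‖z - p‖ ∈ I}.indicator g
      (Complex.polarCoord.symm (x, θ) + p)
      = (I.indicator (fun _ ↦ 1) x) * g (circleMap p x θ) := by
    intro x hx θ
    have h1 : Complex.polarCoord.symm (x, θ) + p = circleMap p x θ := by
      rw [Complex.polarCoord_symm_apply, circleMap, Complex.exp_mul_I]
      push_cast
      ring
    have h2 : ‖circleMap p x θ - p‖ = x := by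
      rw [circleMap_sub_center, norm_circleMap_zero, abs_of_pos hx]
    rw [h1]
    by_cases hxI : x ∈ I
    · rw [Set.indicator_of_mem (by rwa [Set.mem_ofPred_eq, h2]), Set.indicator_of_mem hxI, one_mul]
    · rw [Set.indicator_of_notMem (by rwa [Set.mem_ofPred_eq, h2]),
        Set.indicator_of_notMem hxI, zero_mul]
  have hmeas : Measurable fun x : ℝ × ℝ ↦
      ENNReal.ofReal x.1 • ((I.indicator (fun _ ↦ 1) x.1) * g (circleMap p x.1 x.2)) :=
    (ENNReal.measurable_ofReal.comp measurable_fst).mul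
      (((measurable_const.indicator hI).comp measurable_fst).mul hcm)
  calc _ = ∫⁻ x, ENNReal.ofReal x.1 • ((I.indicator (fun _ ↦ 1) x.1) * g (circleMap p x.1 x.2))
        ∂((volume.restrict (Set.Ioi (0 : ℝ))).prod (volume.restrict (Set.Ioo (-π) π))) := by
        rw [Measure.prod_restrict]
        refine setLIntegral_congr_fun (measurableSet_Ioi.prod measurableSet_Ioo) ?_
        rintro ⟨x, θ⟩ ⟨hx, -⟩
        simp only
        rw [hkey x hx θ]
    _ = ∫⁻ x in Set.Ioi (0 : ℝ), I.indicator (fun x ↦ ENNReal.ofReal x *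
        ∫⁻ θ in Set.Ioo (-π) π, g (circleMap p x θ)) x := by
        rw [lintegral_prod _ hmeas.aemeasurable]
        refine lintegral_congr fun x ↦ ?_
        by_cases hxI : x ∈ I
        · simp only [Set.indicator_of_mem hxI, one_mul, smul_eq_mul]
          rw [lintegral_const_mul' _ _ ENNReal.ofReal_ne_top]
        · simp [Set.indicator_of_notMem hxI]
    _ = _ := by
        rw [lintegral_indicator hI, Measure.restrict_restrict hI]

lemma integrableOn_Ioo_of_circleIntegrable {G : ℂ → ℝ} {p : ℂ} {ρ : ℝ}
    (hG : CircleIntegrable G p ρ) :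
    IntegrableOn (fun θ ↦ G (circleMap p ρ θ)) (Set.Ioo (-π) π) := by
  have hper : Function.Periodic (fun θ ↦ G (circleMap p ρ θ)) (2 * π) := by
    intro θ; simp only [periodic_circleMap p ρ θ]
  have h := hper.intervalIntegrable₀ two_pi_pos.ne' hG (-π) π
  rw [intervalIntegrable_iff_integrableOn_Ioo_of_le (by linarith [pi_pos])] at h
  exact h

lemma integral_Ioo_eq_circleAverage (G : ℂ → ℝ) (p : ℂ) (ρ : ℝ) :
    ∫ θ in Set.Ioo (-π) π, G (circleMap p ρ θ) = 2 * π * circleAverage G p ρ := by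
  rw [circleAverage_eq_integral_add (-π), smul_eq_mul, mul_inv_cancel_left₀ two_pi_pos.ne',
    intervalIntegral.integral_comp_add_right (fun θ ↦ G (circleMap p ρ θ)),
    intervalIntegral.integral_of_le (by linarith [pi_pos]), integral_Ioc_eq_integral_Ioo,
    show 0 + -π = -π by ring, show 2 * π + -π = π by ring]

lemma lintegral_Ioo_eq_circleAverage {G : ℂ → ℝ} {p : ℂ} {ρ : ℝ} (hG : CircleIntegrable G p ρ)
    (h0 : ∀ᵐ θ ∂volume.restrict (Set.Ioo (-π) π), 0 ≤ G (circleMap p ρ θ)) :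
    ∫⁻ θ in Set.Ioo (-π) π, ENNReal.ofReal (G (circleMap p ρ θ))
      = ENNReal.ofReal (2 * π * circleAverage G p ρ) := by
  rw [← integral_Ioo_eq_circleAverage,
    ofReal_integral_eq_lintegral_ofReal (integrableOn_Ioo_of_circleIntegrable hG) h0]

lemma integral_exp_neg_mul_abs_sin_le {k : ℝ} (hk : 0 < k) :
    ∫ t in (-π)..π, exp (-(k * |sin t|)) ≤ 2 * π / k := by
  set F : ℝ → ℝ := fun t ↦ exp (-(k * |sin t|)) with hF
  have hc : Continuous F := by fun_prop
  have hi : ∀ a b, IntervalIntegrable F volume a b := fun a b ↦ hc.intervalIntegrable a b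
  have h1 : ∫ t in (-π)..0, F t = ∫ t in (0 : ℝ)..π, F t := by
    have := intervalIntegral.integral_comp_neg (a := 0) (b := π) F
    rw [neg_zero] at this
    rw [← this]
    simp [hF]
  have h2 : ∫ t in (π / 2)..π, F t = ∫ t in (0 : ℝ)..(π / 2), F t := by
    have := intervalIntegral.integral_comp_sub_left (a := 0) (b := π / 2) F π
    rw [sub_zero, sub_half] at this
    rw [← this]
    simp [hF, sin_pi_sub]
  have h3 : ∫ t in (0 : ℝ)..(π / 2), F t ≤ π / (2 * k) := by
    set a := 2 * k / π with ha
    have ha0 : 0 < a := by positivity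
    have hle : ∫ t in (0 : ℝ)..(π / 2), F t ≤ ∫ t in (0 : ℝ)..(π / 2), exp (-(a * t)) := by
      refine intervalIntegral.integral_mono_on (by positivity) (hi _ _)
        (Continuous.intervalIntegrable (by fun_prop) _ _) fun t ht ↦ ?_
      have := mul_le_sin ht.1 ht.2
      have h0 : 0 ≤ sin t := sin_nonneg_of_nonneg_of_le_pi ht.1 (by linarith [ht.2, pi_pos])
      simp only [hF, exp_le_exp, neg_le_neg_iff]
      rw [abs_of_nonneg h0, ha]
      calc 2 * k / π * t = k * (2 / π * t) := by ring
        _ ≤ k * sin t := by gcongr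
    refine hle.trans ?_
    have hd : ∀ t : ℝ, HasDerivAt (fun t ↦ -(exp (-(a * t)) / a)) (exp (-(a * t))) t := by
      intro t
      have := ((((hasDerivAt_id t).const_mul a).neg).exp.div_const a).neg
      refine this.congr_deriv ?_
      simp
      field_simp
    rw [intervalIntegral.integral_eq_sub_of_hasDerivAt (fun t _ ↦ hd t)
      (Continuous.intervalIntegrable (by fun_prop) _ _)]
    have : π / (2 * k) = 1 / a := by rw [ha]; field_simp
    rw [this]
    simp only [mul_zero, neg_zero, exp_zero]
    have : 0 < exp (-(a * (π / 2))) / a := by positivity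
    linarith
  rw [← intervalIntegral.integral_add_adjacent_intervals (hi (-π) 0) (hi 0 π), h1,
    ← intervalIntegral.integral_add_adjacent_intervals (hi 0 (π / 2)) (hi (π / 2) π), h2]
  have : 2 * π / k = 4 * (π / (2 * k)) := by field_simp; ring
  linarith

lemma circleAverage_exp_neg_abs_dot_le {d : ℂ} (hd : d ≠ 0) {ρ : ℝ} (hρ : 0 < ρ) :
    2 * π * circleAverage (fun z ↦ exp (-|dot d z|)) 0 ρ ≤ 2 * π / (ρ * ‖d‖) := by
  have hk : 0 < ρ * ‖d‖ := mul_pos hρ (norm_pos_iff.mpr hd)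
  refine le_trans (le_of_eq ?_) (integral_exp_neg_mul_abs_sin_le hk)
  set F : ℝ → ℝ := fun t ↦ exp (-(ρ * ‖d‖ * |sin t|)) with hF
  have hper : Function.Periodic F (2 * π) := by
    intro t; simp [hF]
  rw [circleAverage_def, smul_eq_mul, mul_inv_cancel_left₀ two_pi_pos.ne']
  have : ∀ t, exp (-|dot d (circleMap 0 ρ t)|) = F (t + (π / 2 - d.arg)) := by
    intro t
    simp only [hF]
    rw [dot_circleMap, proj_eq_norm_mul_cos, ← mul_assoc, abs_mul, abs_of_pos hk,
      show t + (π / 2 - d.arg) = t - d.arg + π / 2 by ring, sin_add_pi_div_two]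
  simp_rw [this]
  rw [intervalIntegral.integral_comp_add_right F]
  have := hper.intervalIntegral_add_eq (0 + (π / 2 - d.arg)) (-π)
  rw [show 0 + (π / 2 - d.arg) + 2 * π = 2 * π + (π / 2 - d.arg) by ring,
    show -π + 2 * π = π by ring] at this
  exact this

/-- An entire function whose modulus is not small at `p` and not large around `p` has a
logarithm of bounded integral around `p`. -/
lemma lintegral_abs_log_le {f : ℂ → ℂ} (hf : Differentiable ℂ f) {p : ℂ} (hp : f p ≠ 0)
    {R a b : ℝ} (ha : a ≤ log ‖f p‖) (hb : ∀ z, ‖z - p‖ ≤ R → ‖f z‖ ≤ exp b) :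
    ∫⁻ z in Metric.closedBall p R, ENNReal.ofReal |b - log ‖f z‖|
      ≤ ENNReal.ofReal (R * (2 * π * (b - a))) * ENNReal.ofReal R := by
  have hmeas : Measurable fun z ↦ ENNReal.ofReal |b - log ‖f z‖| := by
    have := hf.continuous.measurable
    fun_prop
  have hset : Metric.closedBall p R = {z | ‖z - p‖ ∈ Set.Iic R} := by
    ext z; simp [dist_eq_norm]
  rw [hset, setLIntegral_eq_polar hmeas measurableSet_Iic]
  have hvol : volume (Set.Iic R ∩ Set.Ioi 0) = ENNReal.ofReal R := by
    rw [Set.inter_comm, Set.Ioi_inter_Iic, Real.volume_Ioc, sub_zero]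
  rw [← hvol, ← setLIntegral_const]
  refine setLIntegral_mono' (measurableSet_Iic.inter measurableSet_Ioi) fun ρ hρ ↦ ?_
  have hρ0 : 0 < ρ := hρ.2
  have hρR : ρ ≤ R := hρ.1
  rw [ENNReal.ofReal_mul (hρ0.le.trans hρR)]
  gcongr
  have hci : CircleIntegrable (fun z ↦ log ‖f z‖) p ρ :=
    MeromorphicOn.circleIntegrable_log_norm fun z _ ↦ (hf.analyticAt z).meromorphicAt
  have hcib : CircleIntegrable (fun _ : ℂ ↦ b) p ρ := circleIntegrable_const b p ρ
  have hzeros : ∀ᵐ θ ∂volume.restrict (Set.Ioo (-π) π), f (circleMap p ρ θ) ≠ 0 := by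
    have hfin := finite_zeros_closedBall hf hp (‖p‖ + ρ)
    have hnull := (hfin.countable.preimage_circleMap p hρ0.ne').measure_zero volume
    refine ae_restrict_of_ae ((measure_eq_zero_iff_ae_notMem.mp hnull).mono fun θ hθ h0 ↦ hθ ?_)
    refine ⟨?_, h0⟩
    rw [mem_closedBall_zero_iff]
    calc ‖circleMap p ρ θ‖ = ‖p + (circleMap p ρ θ - p)‖ := by rw [add_sub_cancel]
      _ ≤ _ := by
        refine (norm_add_le _ _).trans ?_
        rw [circleMap_sub_center, norm_circleMap_zero, abs_of_pos hρ0]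
  have hnonneg : ∀ᵐ θ ∂volume.restrict (Set.Ioo (-π) π),
      0 ≤ b - log ‖f (circleMap p ρ θ)‖ := by
    filter_upwards [hzeros] with θ hθ
    rw [sub_nonneg, log_le_iff_le_exp (norm_pos_iff.mpr hθ)]
    exact hb _ (by rwa [circleMap_sub_center, norm_circleMap_zero, abs_of_pos hρ0])
  calc ∫⁻ θ in Set.Ioo (-π) π, ENNReal.ofReal |b - log ‖f (circleMap p ρ θ)‖|
      = ∫⁻ θ in Set.Ioo (-π) π, ENNReal.ofReal (b - log ‖f (circleMap p ρ θ)‖) := by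
        refine lintegral_congr_ae ?_
        filter_upwards [hnonneg] with θ hθ
        rw [abs_of_nonneg hθ]
    _ = ENNReal.ofReal (2 * π * circleAverage (fun z ↦ b - log ‖f z‖) p ρ) :=
        lintegral_Ioo_eq_circleAverage (G := fun z ↦ b - log ‖f z‖) (hcib.sub hci) hnonneg
    _ ≤ ENNReal.ofReal (2 * π * (b - a)) := by
        rw [circleAverage_fun_sub hcib hci, circleAverage_const]
        gcongr
        exact ha.trans (log_norm_le_circleAverage hf hp hρ0)

/-! ### Circle averages of the logarithm of an exponential sum -/

lemma measurable_logDefect (hS : S.Nonempty) :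
    Measurable fun z ↦ ENNReal.ofReal |log ‖expSum S c z‖ - logMaxTerm S hS c z| := by
  have h1 := (differentiable_expSum (S := S) (c := c)).continuous.measurable
  have h2 := (continuous_logMaxTerm (c := c) hS).measurable
  fun_prop

/-- On disks of a fixed radius, the integral of the difference between the logarithm of the
exponential sum and the logarithm of its largest term is bounded uniformly in the center. -/
lemma exists_lintegral_closedBall_le (hS : S.Nonempty) (hc : ∀ l ∈ S, c l ≠ 0) (R : ℝ) :
    ∃ C : ENNReal, C ≠ ⊤ ∧ ∀ p : ℂ, ∫⁻ z in Metric.closedBall p R,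
      ENNReal.ofReal |log ‖expSum S c z‖ - logMaxTerm S hS c z| ≤ C := by
  obtain ⟨k, hk0, -, hk⟩ := exists_coeff_ratio_bound S c
  obtain ⟨R₀, -, hR₀⟩ := exists_near_tailBound_le_half S hk0
  set R' := R + R₀
  set L := ∑ l ∈ S, ‖l‖
  have hL : 0 ≤ L := Finset.sum_nonneg fun _ _ ↦ norm_nonneg _
  set D := L * R' + log S.card
  refine ⟨ENNReal.ofReal (2 * L * R' + log S.card) * (ENNReal.ofReal R' ^ 2 * NNReal.pi)
    + ENNReal.ofReal (R' * (2 * π * (D + 1))) * ENNReal.ofReal R', ?_, fun p ↦ ?_⟩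
  · finiteness
  obtain ⟨p', hp', hQ⟩ := hR₀ p
  obtain ⟨hne, hW⟩ := abs_log_sub_logMaxTerm_le hS hc hk hk0 hQ
  set b := logMaxTerm S hS c p' + D
  have hlip : ∀ z, ‖z - p'‖ ≤ R' →
      |logMaxTerm S hS c z - logMaxTerm S hS c p'| ≤ L * R' := fun z hz ↦
    (abs_logMaxTerm_sub_le hS c z p').trans (by gcongr)
  have hb : ∀ z, ‖z - p'‖ ≤ R' → ‖expSum S c z‖ ≤ exp b := by
    intro z hz
    refine (norm_expSum_le hS hc z).trans (exp_le_exp.mpr ?_)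
    have := (abs_le.mp (hlip z hz)).2
    simp only [b, D]
    linarith
  have hmain := lintegral_abs_log_le differentiable_expSum hne
    (a := logMaxTerm S hS c p' - 1) (by have := (abs_le.mp hW).1; linarith) hb
  rw [show b - (logMaxTerm S hS c p' - 1) = D + 1 by simp only [b]; ring] at hmain
  have hn : 0 ≤ log (S.card : ℝ) := log_natCast_nonneg _
  calc _ ≤ ∫⁻ z in Metric.closedBall p' R',
        ENNReal.ofReal |log ‖expSum S c z‖ - logMaxTerm S hS c z| := by
        refine lintegral_mono_set (Metric.closedBall_subset_closedBall' ?_)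
        rw [dist_comm, dist_eq_norm]
        simp only [R']
        linarith
    _ ≤ ∫⁻ z in Metric.closedBall p' R', (ENNReal.ofReal (2 * L * R' + log S.card)
          + ENNReal.ofReal |b - log ‖expSum S c z‖|) := by
        refine setLIntegral_mono' measurableSet_closedBall fun z hz ↦ ?_
        rw [mem_closedBall_iff_norm] at hz
        have h1 := abs_le.mp (hlip z hz)
        rw [← ENNReal.ofReal_add (by linarith) (abs_nonneg _)]
        refine ENNReal.ofReal_le_ofReal ?_
        calc _ = |(b - logMaxTerm S hS c z) - (b - log ‖expSum S c z‖)| := by ring_nf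
          _ ≤ |b - logMaxTerm S hS c z| + |b - log ‖expSum S c z‖| := abs_sub _ _
          _ ≤ _ := by
            gcongr
            rw [abs_le]
            simp only [b, D]
            constructor <;> linarith
    _ ≤ _ := by
        rw [lintegral_add_left measurable_const, setLIntegral_const, Complex.volume_closedBall]
        gcongr

/-- The part of an annulus of width one near the line orthogonal to `d` is covered by two
disks. -/
lemma exists_cover_strip {d : ℂ} (hd : d ≠ 0) (K : ℝ) :
    ∃ R : ℝ, ∀ r : ℝ, 0 ≤ r → ∃ p q : ℂ, ∀ z : ℂ, ‖z‖ ∈ Set.Icc r (r + 1) → |dot d z| < K →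
      z ∈ Metric.closedBall p R ∨ z ∈ Metric.closedBall q R := by
  have hpos : 0 < ‖d‖ := norm_pos_iff.mpr hd
  have hdn : (‖d‖ : ℂ) ≠ 0 := by exact_mod_cast hpos.ne'
  set u : ℂ := Complex.I * d / ‖d‖ with hu
  have hu1 : ‖u‖ = 1 := by simp [hu, hpos.ne']
  have hu0 : u ≠ 0 := by rw [← norm_ne_zero_iff, hu1]; exact one_ne_zero
  refine ⟨1 + 2 * (K / ‖d‖), fun r hr ↦ ⟨r * u, -(r * u), fun z hz hzK ↦ ?_⟩⟩
  -- The coordinate `ζ = z / u` turns the line into the real axis.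
  obtain ⟨ζ, rfl⟩ : ∃ ζ, z = ζ * u := ⟨z / u, by rw [div_mul_cancel₀ _ hu0]⟩
  rw [norm_mul, hu1, mul_one] at hz
  have him : |ζ.im| < K / ‖d‖ := by
    have hdot : dot d (ζ * u) = -(‖d‖ * ζ.im) := by
      have h1 : (‖d‖ : ℝ) * ‖d‖ = d.re * d.re + d.im * d.im := by
        rw [← Complex.normSq_apply, Complex.normSq_eq_norm_sq, sq]
      have hure : u.re = -d.im / ‖d‖ := by simp [hu, Complex.div_ofReal_re]
      have huim : u.im = d.re / ‖d‖ := by simp [hu, Complex.div_ofReal_im]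
      rw [dot, Complex.mul_re, Complex.mul_im, hure, huim]
      field_simp
      linear_combination ζ.im * h1
    rw [hdot, abs_neg, abs_mul, abs_of_pos hpos] at hzK
    rw [lt_div_iff₀ hpos]
    linarith
  have hre := Complex.abs_re_le_norm ζ
  have hri := Complex.norm_le_abs_re_add_abs_im ζ
  have hbound : ∀ x : ℝ, |ζ.re - x| ≤ 1 + |ζ.im| → ‖ζ * u - x * u‖ ≤ 1 + 2 * (K / ‖d‖) := by
    intro x hx
    rw [← sub_mul, norm_mul, hu1, mul_one]
    refine (Complex.norm_le_abs_re_add_abs_im _).trans ?_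
    simp only [Complex.sub_re, Complex.ofReal_re, Complex.sub_im, Complex.ofReal_im, sub_zero]
    linarith
  rw [mem_closedBall_iff_norm, mem_closedBall_iff_norm]
  have hz1 := hz.1
  have hz2 := hz.2
  have him0 := abs_nonneg ζ.im
  rcases le_total 0 ζ.re with h | h
  · left
    rw [abs_of_nonneg h] at hre hri
    exact hbound r (abs_le.mpr ⟨by linarith, by linarith⟩)
  · right
    rw [abs_of_nonpos h] at hre hri
    have := hbound (-r) (abs_le.mpr ⟨by linarith, by linarith⟩)
    rwa [Complex.ofReal_neg, neg_mul] at this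

lemma exists_lintegral_tailBound_le (S : Finset ℂ) {k : ℝ} (hk : 0 < k) :
    ∃ C : ENNReal, C ≠ ⊤ ∧ ∀ r : ℝ, 1 ≤ r →
      ∫⁻ z in {z | ‖z - 0‖ ∈ Set.Icc r (r + 1)}, ENNReal.ofReal (2 * tailBound S k z) ≤ C := by
  set D := 2 * ∑ p ∈ S.offDiag, k * (2 * π / ‖p.1 - p.2‖) with hD
  refine ⟨ENNReal.ofReal D, ENNReal.ofReal_ne_top, fun r hr ↦ ?_⟩
  have hQ := continuous_tailBound (S := S) k
  have hmeas : Measurable fun z ↦ ENNReal.ofReal (2 * tailBound S k z) :=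
    (hQ.const_smul (2 : ℝ)).measurable.ennreal_ofReal
  rw [setLIntegral_eq_polar hmeas measurableSet_Icc]
  have hvol : volume (Set.Icc r (r + 1) ∩ Set.Ioi 0) ≤ 1 := by
    refine (measure_mono Set.inter_subset_left).trans ?_
    simp
  calc _ ≤ ∫⁻ ρ in Set.Icc r (r + 1) ∩ Set.Ioi 0, ENNReal.ofReal D := by
        refine setLIntegral_mono' (measurableSet_Icc.inter measurableSet_Ioi) fun ρ hρ ↦ ?_
        have hρ0 : 0 < ρ := hρ.2
        have hcont : Continuous fun z ↦ 2 * tailBound S k z := by fun_prop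
        rw [lintegral_Ioo_eq_circleAverage (G := fun z ↦ 2 * tailBound S k z)
          (hcont.comp (continuous_circleMap 0 ρ) |>.intervalIntegrable _ _)
          (Filter.Eventually.of_forall fun θ ↦ mul_nonneg zero_le_two
            (Finset.sum_nonneg fun p _ ↦ by positivity)), ← ENNReal.ofReal_mul hρ0.le]
        refine ENNReal.ofReal_le_ofReal ?_
        have hci : ∀ d : ℂ, CircleIntegrable (fun z ↦ k * exp (-|dot d z|)) 0 ρ := by
          intro d
          have : Continuous fun z ↦ k * exp (-|dot d z|) := by unfold dot; fun_prop
          exact (this.comp (continuous_circleMap 0 ρ)).intervalIntegrable _ _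
        have hav : circleAverage (fun z ↦ 2 * tailBound S k z) 0 ρ
            = 2 * ∑ p ∈ S.offDiag, k * circleAverage (fun z ↦ exp (-|dot (p.1 - p.2) z|)) 0 ρ := by
          simp only [tailBound]
          simp_rw [← smul_eq_mul (2 : ℝ)]
          rw [circleAverage_fun_smul, circleAverage_fun_sum fun p _ ↦ hci _]
          congr 1
          refine Finset.sum_congr rfl fun p _ ↦ ?_
          simp_rw [← smul_eq_mul k]
          rw [circleAverage_fun_smul]
        rw [hav, hD, show ∀ x : ℝ, ρ * (2 * π * (2 * x)) = 2 * (x * (2 * π * ρ)) by intro x; ring,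
          Finset.sum_mul]
        refine mul_le_mul_of_nonneg_left (Finset.sum_le_sum fun p hp ↦ ?_) zero_le_two
        have hne : p.1 - p.2 ≠ 0 := sub_ne_zero.mpr (Finset.mem_offDiag.mp hp).2.2
        have hpos : 0 < ‖p.1 - p.2‖ := norm_pos_iff.mpr hne
        have h := mul_le_mul_of_nonneg_left (circleAverage_exp_neg_abs_dot_le hne hρ0) hρ0.le
        rw [show ρ * (2 * π / (ρ * ‖p.1 - p.2‖)) = 2 * π / ‖p.1 - p.2‖ by field_simp] at h
        rw [mul_assoc]
        gcongr
        linarith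
    _ ≤ ENNReal.ofReal D * 1 := by
        rw [setLIntegral_const]
        gcongr
    _ = _ := mul_one _

/-- On annuli of width one, the integral of the difference between the logarithm of the
exponential sum and the logarithm of its largest term is bounded, although the area grows. -/
lemma exists_lintegral_annulus_le (hS : S.Nonempty) (hc : ∀ l ∈ S, c l ≠ 0) :
    ∃ C : ENNReal, C ≠ ⊤ ∧ ∀ r : ℝ, 1 ≤ r → ∫⁻ z in {z | ‖z - 0‖ ∈ Set.Icc r (r + 1)},
      ENNReal.ofReal |log ‖expSum S c z‖ - logMaxTerm S hS c z| ≤ C := by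
  obtain ⟨k, hk0, -, hk⟩ := exists_coeff_ratio_bound S c
  obtain ⟨K, hK⟩ := exists_tailBound_le_half S hk0
  obtain ⟨C₁, hC₁, hC₁'⟩ := exists_lintegral_tailBound_le S hk0
  have hcov : ∀ p ∈ S.offDiag, ∃ C : ENNReal, C ≠ ⊤ ∧ ∀ r : ℝ, 1 ≤ r → ∃ B : Set ℂ,
      MeasurableSet B ∧
      (∀ z : ℂ, ‖z‖ ∈ Set.Icc r (r + 1) → |dot (p.1 - p.2) z| < K → z ∈ B) ∧
      ∫⁻ z in B, ENNReal.ofReal |log ‖expSum S c z‖ - logMaxTerm S hS c z| ≤ C := by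
    intro p hp
    obtain ⟨R, hR⟩ := exists_cover_strip (sub_ne_zero.mpr (Finset.mem_offDiag.mp hp).2.2) K
    obtain ⟨C, hC, hC'⟩ := exists_lintegral_closedBall_le hS hc R
    refine ⟨C + C, by finiteness, fun r hr ↦ ?_⟩
    obtain ⟨x, y, hxy⟩ := hR r (by linarith)
    exact ⟨Metric.closedBall x R ∪ Metric.closedBall y R,
      measurableSet_closedBall.union measurableSet_closedBall, hxy,
      (lintegral_union_le _ _ _).trans (add_le_add (hC' x) (hC' y))⟩
  choose! C₂ hC₂ hcov using hcov
  refine ⟨C₁ + ∑ p ∈ S.offDiag, C₂ p, ?_, fun r hr ↦ ?_⟩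
  · exact ENNReal.add_ne_top.mpr ⟨hC₁, ENNReal.sum_ne_top.mpr hC₂⟩
  choose! B hBm hB hBC using fun p hp ↦ hcov p hp r hr
  have hmW := measurable_logDefect (c := c) hS
  set W : ℂ → ENNReal := fun z ↦
    ENNReal.ofReal |log ‖expSum S c z‖ - logMaxTerm S hS c z| with hW
  have hmeas : Measurable fun z ↦ ENNReal.ofReal (2 * tailBound S k z) :=
    ((continuous_tailBound (S := S) k).const_smul (2 : ℝ)).measurable.ennreal_ofReal
  have hA : MeasurableSet {z : ℂ | ‖z - 0‖ ∈ Set.Icc r (r + 1)} :=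
    (measurable_norm.comp (measurable_id.sub_const 0)) measurableSet_Icc
  calc ∫⁻ z in {z | ‖z - 0‖ ∈ Set.Icc r (r + 1)}, W z
      ≤ ∫⁻ z in {z | ‖z - 0‖ ∈ Set.Icc r (r + 1)}, (ENNReal.ofReal (2 * tailBound S k z)
        + ∑ p ∈ S.offDiag, (B p).indicator W z) := by
        refine setLIntegral_mono' hA fun z hz ↦ ?_
        rw [Set.mem_ofPred_eq, sub_zero] at hz
        by_cases hfar : ∀ p ∈ S.offDiag, K ≤ |dot (p.1 - p.2) z|
        · exact (ENNReal.ofReal_le_ofReal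
            (abs_log_sub_logMaxTerm_le hS hc hk hk0 (hK z hfar)).2).trans le_self_add
        · push Not at hfar
          obtain ⟨p, hp, hlt⟩ := hfar
          calc W z = (B p).indicator W z := (Set.indicator_of_mem (hB p hp z hz hlt) W).symm
            _ ≤ ∑ p ∈ S.offDiag, (B p).indicator W z :=
              Finset.single_le_sum (f := fun p ↦ (B p).indicator W z) (fun _ _ ↦ zero_le) hp
            _ ≤ _ := le_add_self
    _ = (∫⁻ z in {z | ‖z - 0‖ ∈ Set.Icc r (r + 1)}, ENNReal.ofReal (2 * tailBound S k z))
        + ∑ p ∈ S.offDiag, ∫⁻ z in {z | ‖z - 0‖ ∈ Set.Icc r (r + 1)}, (B p).indicator W z := by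
        rw [lintegral_add_left hmeas,
          lintegral_finsetSum _ fun p hp ↦ hmW.indicator (hBm p hp)]
    _ ≤ _ := by
        refine add_le_add (hC₁' r hr) (Finset.sum_le_sum fun p hp ↦ ?_)
        refine (setLIntegral_le_lintegral _ _).trans ?_
        rw [lintegral_indicator (hBm p hp)]
        exact hBC p hp

/-- In every interval of length one there is a radius for which the circle averages of the
logarithm of the exponential sum and of the logarithm of its largest term almost agree. -/
lemma exists_radius_circleAverage_close (hS : S.Nonempty) (hc : ∀ l ∈ S, c l ≠ 0) :
    ∃ C : ℝ, 0 ≤ C ∧ ∀ r : ℝ, 1 ≤ r → ∃ s ∈ Set.Icc r (r + 1),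
      |circleAverage (fun z ↦ log ‖expSum S c z‖) 0 s - circleAverage (logMaxTerm S hS c) 0 s|
        ≤ C / s := by
  obtain ⟨C, hC, hann⟩ := exists_lintegral_annulus_le hS hc
  refine ⟨(C + 1).toReal, ENNReal.toReal_nonneg, fun r hr ↦ ?_⟩
  have h := hann r hr
  rw [setLIntegral_eq_polar (measurable_logDefect hS) measurableSet_Icc,
    Set.inter_eq_left.mpr fun x (hx : x ∈ Set.Icc r (r + 1)) ↦
      Set.mem_Ioi.mpr (by linarith [hx.1])] at h
  obtain ⟨s, hs, hsC⟩ : ∃ s ∈ Set.Icc r (r + 1), ENNReal.ofReal s * ∫⁻ θ in Set.Ioo (-π) π,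
      ENNReal.ofReal |log ‖expSum S c (circleMap 0 s θ)‖ - logMaxTerm S hS c (circleMap 0 s θ)|
        ≤ C + 1 := by
    -- The value `C + 1` leaves room for a strict inequality between the integrals.
    by_contra! hbig
    have h2 : ∫⁻ _ in Set.Icc r (r + 1), (C + 1) ≤ C :=
      (setLIntegral_mono' measurableSet_Icc fun s hs ↦ (hbig s hs).le).trans h
    rw [setLIntegral_const, Real.volume_Icc, add_sub_cancel_left, ENNReal.ofReal_one,
      mul_one] at h2
    exact absurd h2 (not_le.mpr (ENNReal.lt_add_right hC one_ne_zero))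
  refine ⟨s, hs, ?_⟩
  have hs0 : 0 < s := by linarith [hs.1]
  have hci : CircleIntegrable (fun z ↦ log ‖expSum S c z‖) 0 s :=
    MeromorphicOn.circleIntegrable_log_norm fun z _ ↦
      (differentiable_expSum.analyticAt z).meromorphicAt
  have hciH : CircleIntegrable (logMaxTerm S hS c) 0 s :=
    ((continuous_logMaxTerm hS).comp (continuous_circleMap 0 s)).intervalIntegrable _ _
  have hciW : CircleIntegrable (fun z ↦ |log ‖expSum S c z‖ - logMaxTerm S hS c z|) 0 s :=
    (hci.sub hciH).abs
  rw [lintegral_Ioo_eq_circleAverage hciW (Filter.Eventually.of_forall fun θ ↦ abs_nonneg _),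
    ← ENNReal.ofReal_mul hs0.le, ENNReal.ofReal_le_iff_le_toReal (by finiteness)] at hsC
  have hle : |circleAverage (fun z ↦ log ‖expSum S c z‖) 0 s
      - circleAverage (logMaxTerm S hS c) 0 s|
      ≤ circleAverage (fun z ↦ |log ‖expSum S c z‖ - logMaxTerm S hS c z|) 0 s := by
    rw [← circleAverage_fun_sub hci hciH]
    exact abs_circleAverage_le_circleAverage_abs
  rw [le_div_iff₀ hs0]
  set X := circleAverage (fun z ↦ |log ‖expSum S c z‖ - logMaxTerm S hS c z|) 0 s
  have hX : 0 ≤ X := (abs_nonneg _).trans hle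
  calc _ ≤ X * s := by gcongr
    _ ≤ s * (2 * π * X) := by
      have : 1 ≤ 2 * π := by linarith [pi_gt_three]
      nlinarith [mul_nonneg hs0.le hX]
    _ ≤ _ := hsC

lemma exists_expSum_ne_zero (hS : S.Nonempty) (hc : ∀ l ∈ S, c l ≠ 0) :
    ∃ z, expSum S c z ≠ 0 := by
  obtain ⟨k, hk0, -, hk⟩ := exists_coeff_ratio_bound S c
  obtain ⟨R, -, hR⟩ := exists_near_tailBound_le_half S hk0
  obtain ⟨z, -, hz⟩ := hR 0
  exact ⟨z, (abs_log_sub_logMaxTerm_le hS hc hk hk0 hz).1⟩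

lemma perimeter_nonneg (P : Set ℂ) : 0 ≤ perimeter P :=
  finsum_nonneg fun _ ↦ finsum_nonneg fun _ ↦ dist_nonneg

/-- The increment of the circle average of the logarithm of an exponential sum, between suitable
radii in consecutive intervals. -/
lemma exists_radii_increment (hS : S.Nonempty) (hc : ∀ l ∈ S, c l ≠ 0) :
    ∃ B : ℝ, 0 ≤ B ∧ ∀ r : ℝ, 1 ≤ r → ∃ s₁ ∈ Set.Icc r (r + 1), ∃ s₂ ∈ Set.Icc (r + 2) (r + 3),
      |circleAverage (fun z ↦ log ‖expSum S c z‖) 0 s₂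
        - circleAverage (fun z ↦ log ‖expSum S c z‖) 0 s₁
        - (s₂ - s₁) * (perimeter (newtonPolygon S) / (2 * π))| ≤ (s₂ - s₁) * (B / s₁) := by
  obtain ⟨k, hk0, hk1, hk⟩ := exists_coeff_ratio_bound S c
  obtain ⟨C, hC, hrad⟩ := exists_radius_circleAverage_close hS hc
  refine ⟨log k + 2 * C, by positivity, fun r hr ↦ ?_⟩
  obtain ⟨s₁, hs₁, h1⟩ := hrad r hr
  obtain ⟨s₂, hs₂, h2⟩ := hrad (r + 2) (by linarith)
  rw [show r + 2 + 1 = r + 3 by ring] at hs₂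
  refine ⟨s₁, hs₁, s₂, hs₂, ?_⟩
  have hs1 : 0 < s₁ := by linarith [hs₁.1]
  have h12 : s₁ + 1 ≤ s₂ := by linarith [hs₁.2, hs₂.1]
  have h3 := circleAverage_logMaxTerm_sub (c := c) hS hk hk1 hs1 (by linarith : s₁ ≤ s₂)
  have h4 : C / s₂ ≤ C / s₁ := by gcongr; linarith
  have h5 : 2 * (C / s₁) ≤ (s₂ - s₁) * (2 * (C / s₁)) :=
    le_mul_of_one_le_left (by positivity) (by linarith)
  rw [show (log k + 2 * C) / s₁ = log k / s₁ + 2 * (C / s₁) by ring]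
  rw [abs_le] at *
  constructor <;> linarith [h1.1, h1.2, h2.1, h2.2, h3.1, h3.2]

end ExpSum

end

theorem mainTheorem9 (S : Finset ℂ) (hS : S.Nonempty) (c : ℂ → ℂ) (hc : ∀ l ∈ S, c l ≠ 0) :
    ∃ C : ℝ, ∀ r : ℝ, 0 ≤ r →
      (ExpSum.zerosInDisk (ExpSum.expSum S c) r).Finite ∧
      |(ExpSum.zeroCount (ExpSum.expSum S c) r : ℝ)
        - r / Real.pi * ExpSum.semiperimeter (ExpSum.newtonPolygon S)| ≤ C := by
  obtain ⟨B, hB, hinc⟩ := ExpSum.exists_radii_increment hS hc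
  obtain ⟨z₀, hz₀⟩ := ExpSum.exists_expSum_ne_zero hS hc
  have hf : Differentiable ℂ (ExpSum.expSum S c) := ExpSum.differentiable_expSum
  set A : ℝ := ExpSum.perimeter (ExpSum.newtonPolygon S) / (2 * Real.pi) with hA
  have hA0 : 0 ≤ A := div_nonneg (ExpSum.perimeter_nonneg _) Real.two_pi_pos.le
  have hmain : ∀ r : ℝ, r / Real.pi * ExpSum.semiperimeter (ExpSum.newtonPolygon S) = r * A := by
    intro r
    rw [ExpSum.semiperimeter, hA]
    field_simp
  have hupper : ∀ r : ℝ, 1 ≤ r →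
      (ExpSum.zeroCount (ExpSum.expSum S c) r : ℝ) ≤ r * A + (3 * A + 4 * B) := by
    intro r hr
    obtain ⟨s₁, hs₁, s₂, hs₂, h⟩ := hinc r hr
    have h1 : 0 < s₁ := by linarith [hs₁.1]
    have h12 : 1 ≤ s₂ - s₁ := by linarith [hs₁.2, hs₂.1]
    have h2 : 0 < s₂ := by linarith
    have hJ := ExpSum.zeroCount_mul_log_le hf hz₀ h1 (by linarith : s₁ ≤ s₂) hs₁.1
    have hlog : (s₂ - s₁) / s₂ ≤ Real.log s₂ - Real.log s₁ := by
      have := Real.one_sub_inv_le_log_of_pos (div_pos h2 h1)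
      rw [Real.log_div h2.ne' h1.ne', inv_div] at this
      rwa [sub_div, div_self h2.ne']
    have hn : (0 : ℝ) ≤ ExpSum.zeroCount (ExpSum.expSum S c) r := Nat.cast_nonneg _
    have h3 : (ExpSum.zeroCount (ExpSum.expSum S c) r : ℝ) * ((s₂ - s₁) / s₂)
        ≤ (s₂ - s₁) * (A + B / s₁) := by
      have := mul_le_mul_of_nonneg_left hlog hn
      linarith [(abs_le.mp h).2]
    have h4 : (ExpSum.zeroCount (ExpSum.expSum S c) r : ℝ) ≤ s₂ * (A + B / s₁) := by
      have h5 : 0 < (s₂ - s₁) / s₂ := by positivity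
      refine le_of_mul_le_mul_right (h3.trans (le_of_eq ?_)) h5
      field_simp
    have h6 : s₂ * (B / s₁) ≤ 4 * B := by
      rw [mul_div_assoc', div_le_iff₀ h1]
      nlinarith [hs₁.1, hs₂.2]
    nlinarith [hs₂.2]
  have hlower : ∀ r : ℝ, 6 ≤ r →
      r * A - (4 * A + B) ≤ (ExpSum.zeroCount (ExpSum.expSum S c) r : ℝ) := by
    intro r hr
    -- Both radii have to be smaller than `r`, with `s₂ ≤ r - 1`.
    obtain ⟨s₁, hs₁, s₂, hs₂, h⟩ := hinc (r - 4) (by linarith)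
    have h1 : 0 < s₁ := by linarith [hs₁.1]
    have h12 : 1 ≤ s₂ - s₁ := by linarith [hs₁.2, hs₂.1]
    have h2 : 0 < s₂ := by linarith
    have hJ := ExpSum.le_zeroCount_mul_log hf hz₀ h1 (by linarith : s₁ ≤ s₂)
      (by linarith [hs₂.2] : s₂ < r)
    have hlog : Real.log s₂ - Real.log s₁ ≤ (s₂ - s₁) / s₁ := by
      have := Real.log_le_sub_one_of_pos (div_pos h2 h1)
      rw [Real.log_div h2.ne' h1.ne'] at this
      rwa [sub_div, div_self h1.ne']
    have hn : (0 : ℝ) ≤ ExpSum.zeroCount (ExpSum.expSum S c) r := Nat.cast_nonneg _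
    have h3 : (s₂ - s₁) * (A - B / s₁)
        ≤ (ExpSum.zeroCount (ExpSum.expSum S c) r : ℝ) * ((s₂ - s₁) / s₁) := by
      have := mul_le_mul_of_nonneg_left hlog hn
      linarith [(abs_le.mp h).1]
    have h4 : s₁ * (A - B / s₁) ≤ (ExpSum.zeroCount (ExpSum.expSum S c) r : ℝ) := by
      have h5 : 0 < (s₂ - s₁) / s₁ := by positivity
      refine le_of_mul_le_mul_right (le_trans (le_of_eq ?_) h3) h5
      field_simp
    rw [mul_sub, mul_div_cancel₀ _ h1.ne'] at h4
    nlinarith [hs₁.1]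
  refine ⟨6 * A + 4 * B, fun r hr ↦ ⟨ExpSum.finite_zerosInDisk hf hz₀ r, ?_⟩⟩
  rw [hmain, abs_le]
  have hn : (0 : ℝ) ≤ ExpSum.zeroCount (ExpSum.expSum S c) r := Nat.cast_nonneg _
  have hrA : 0 ≤ r * A := mul_nonneg hr hA0
  constructor
  · rcases le_total 6 r with h | h
    · linarith [hlower r h]
    · nlinarith
  · rcases le_total 1 r with h | h
    · linarith [hupper r h]
    · have h1 : (ExpSum.zeroCount (ExpSum.expSum S c) r : ℝ)
          ≤ ExpSum.zeroCount (ExpSum.expSum S c) 1 := by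
        exact_mod_cast ExpSum.zeroCount_mono hf hz₀ h
      linarith [hupper 1 le_rfl]
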